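/- Let $A$ be a (not necessarily unital or separable) C*-algebra, $G$ a finite group and $\alpha : G \to \mathrm{Aut}(A)$ an action of $G$ on $A$ by $*$-automorphisms. The crossed product $A\rtimes_\alpha G$ is the C*-algebra of all functions $f : G\to A$ with $(fh)(g)=\sum_{p\in G} f(p)\,\alpha_p(h(p^{-1}g))$, $f^*(g)=\alpha_g(f(g^{-1})^*)$ and its C*-norm (the $*$-algebra is complete in this norm because $G$ is finite). Let $M(A)$ be the multiplier algebra of $A$, and let $M_{loc}(A)$, the algebra of local multipliers, be the C*-algebraic inductive limit of the algebras $M(I)$, where $I$ runs through the closed essential two-sided ideals of $A$ ordered by reverse inclusion, with the canonical embeddings $M(J)\subset M(I)$ for $I\subset J$; $I$ is essential if $aI=0$ implies $a=0$. The action $\alpha$ extends canonically to actions, also denoted $\alpha$, on $M(A)$ and on $M_{loc}(A)$. a) $M(A\rtimes_\alpha G)=M(A)\rtimes_\alpha G$; that is, there is a $*$-isomorphism of $M(A\rtimes_\alpha G)$ onto $M(A)\rtimes_\alpha G$ which restricts to the canonical inclusion $f\mapsto (g\mapsto f(g))$ of $A\rtimes_\alpha G$ into $M(A)\rtimes_\alpha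 G$. b) Suppose that $A$ is prime (every nonzero two-sided ideal is essential) and that $\alpha$ is properly outer, that is, for no $g\neq e$ is there a unitary $u\in M_{loc}(A)$ with $\alpha_g(a)=uau^*$ for all $a\in A$. Then $M_{loc}(A\rtimes_\alpha G)$ is $*$-isomorphic to $M_{loc}(A)\rtimes_\alpha G$, by an isomorphism which restricts to the canonical inclusion of $A\rtimes_\alpha G$ into $M_{loc}(A)\rtimes_\alpha G$. -/

import Mathlib

open scoped MultiplierAlgebra Topology

set_option linter.unusedSectionVars false

noncomputable section

namespace CStarDyn

universe u v

section Multipliers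

variable {A B C : Type*} [NonUnitalCStarAlgebra A] [NonUnitalCStarAlgebra B]
  [NonUnitalCStarAlgebra C]

lemma multiplier_ext {m n : 𝓜(ℂ, A)} (h₁ : ∀ x, m.fst x = n.fst x)
    (h₂ : ∀ x, m.snd x = n.snd x) : m = n :=
  DoubleCentralizer.ext _ _ _ _
    (Prod.ext (ContinuousLinearMap.ext h₁) (ContinuousLinearMap.ext h₂))

/-- A `*`-isomorphism of C*-algebras (automatically isometric) as a bounded linear map. -/
def equivCLM (e : A ≃⋆ₐ[ℂ] B) : A →L[ℂ] B :=
  LinearMap.mkContinuous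
    { toFun := e, map_add' := map_add e, map_smul' := fun c x => map_smul e c x } 1
    (fun x => by simp [StarAlgEquiv.norm_map e x])

@[simp] lemma equivCLM_apply (e : A ≃⋆ₐ[ℂ] B) (x : A) : equivCLM e x = e x := rfl

/-- Transport of a multiplier `(L, R)` along a `*`-isomorphism `e`:
it becomes `(e ∘ L ∘ e⁻¹, e ∘ R ∘ e⁻¹)`. -/
def multiplierTransport (e : A ≃⋆ₐ[ℂ] B) (m : 𝓜(ℂ, A)) : 𝓜(ℂ, B) where
  fst := (equivCLM e).comp (m.fst.comp (equivCLM e.symm))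
  snd := (equivCLM e).comp (m.snd.comp (equivCLM e.symm))
  central x y := by
    change e (m.snd (e.symm x)) * y = x * e (m.fst (e.symm y))
    have h := congrArg e (m.central (e.symm x) (e.symm y))
    simpa only [map_mul, StarAlgEquiv.apply_symm_apply] using h

@[simp] lemma multiplierTransport_fst (e : A ≃⋆ₐ[ℂ] B) (m : 𝓜(ℂ, A)) (x : B) :
    (multiplierTransport e m).fst x = e (m.fst (e.symm x)) := rfl

@[simp] lemma multiplierTransport_snd (e : A ≃⋆ₐ[ℂ] B) (m : 𝓜(ℂ, A)) (x : B) :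
    (multiplierTransport e m).snd x = e (m.snd (e.symm x)) := rfl

/-- The `*`-isomorphism `M(A) ≃ M(B)` induced by a `*`-isomorphism `A ≃ B`. -/
def multiplierEquiv (e : A ≃⋆ₐ[ℂ] B) : 𝓜(ℂ, A) ≃⋆ₐ[ℂ] 𝓜(ℂ, B) where
  toFun := multiplierTransport e
  invFun := multiplierTransport e.symm
  left_inv m := multiplier_ext (fun x => by simp) (fun x => by simp)
  right_inv m := multiplier_ext (fun x => by simp) (fun x => by simp)
  map_mul' m n := multiplier_ext (fun x => by simp) (fun x => by simp)
  map_add' m n := multiplier_ext (fun x => by simp) (fun x => by simp)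
  map_star' m := multiplier_ext (fun x => by simp [map_star]) (fun x => by simp [map_star])
  map_smul' c m := multiplier_ext (fun x => by simp [map_smul]) (fun x => by simp [map_smul])

@[simp] lemma multiplierEquiv_fst (e : A ≃⋆ₐ[ℂ] B) (m : 𝓜(ℂ, A)) (x : B) :
    (multiplierEquiv e m).fst x = e (m.fst (e.symm x)) := rfl

@[simp] lemma multiplierEquiv_snd (e : A ≃⋆ₐ[ℂ] B) (m : 𝓜(ℂ, A)) (x : B) :
    (multiplierEquiv e m).snd x = e (m.snd (e.symm x)) := rfl

/-- The canonical extension to `M(A)` of an action of a group on `A`. -/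
def multiplierAction {G : Type*} [Group G] (α : G →* (A ≃⋆ₐ[ℂ] A)) :
    G →* (𝓜(ℂ, A) ≃⋆ₐ[ℂ] 𝓜(ℂ, A)) where
  toFun g := multiplierEquiv (α g)
  map_one' := StarAlgEquiv.ext fun m =>
    multiplier_ext (fun x => by simp; rfl) (fun x => by simp; rfl)
  map_mul' g h := StarAlgEquiv.ext fun m =>
    multiplier_ext (fun x => by simp; rfl) (fun x => by simp; rfl)

end Multipliers

/-! ### Crossed products by finite groups -/

section CrossedProduct

variable {A : Type u} [NonUnitalCStarAlgebra A] {G : Type v} [Group G]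

/-- The crossed product of a C*-algebra `A` by an action `α` of a finite group `G`: the space of
all functions `G → A`, with twisted convolution as product. For finite `G` this `*`-algebra is
already complete in its C*-norm (see the `CompleteSpace` instance and `norm_map_le` below), so it is
its own C*-completion. -/
def CrossedProduct (_α : G →* (A ≃⋆ₐ[ℂ] A)) : Type (max u v) := G → A

namespace CrossedProduct

variable {α : G →* (A ≃⋆ₐ[ℂ] A)}

attribute [local instance] CStarAlgebra.spectralOrder CStarAlgebra.spectralOrderedRing

instance : AddCommGroup (CrossedProduct α) := inferInstanceAs (AddCommGroup (G → A))

instance : Module ℂ (CrossedProduct α) := inferInstanceAs (Module ℂ (G → A))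

@[ext] lemma ext {f h : CrossedProduct α} (H : ∀ g, f g = h g) : f = h := funext H

@[simp] lemma zero_apply (g : G) : (0 : CrossedProduct α) g = 0 := rfl
@[simp] lemma add_apply (f h : CrossedProduct α) (g : G) : (f + h) g = f g + h g := rfl
@[simp] lemma neg_apply (f : CrossedProduct α) (g : G) : (-f) g = -f g := rfl
@[simp] lemma sub_apply (f h : CrossedProduct α) (g : G) : (f - h) g = f g - h g := rfl
@[simp] lemma smul_apply (c : ℂ) (f : CrossedProduct α) (g : G) : (c • f) g = c • f g := rfl

/-- `f* (g) = α_g (f (g⁻¹)*)`. -/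
instance : Star (CrossedProduct α) where
  star f := fun g => α g (star (f g⁻¹))

lemma star_apply (f : CrossedProduct α) (g : G) : (star f) g = α g (star (f g⁻¹)) := rfl

/-- The matrix, with entries in `A`, of the regular representation:
`(f ξ)(p) = ∑ q, α_{p⁻¹} (f (p q⁻¹)) ξ(q)`. -/
def toMatrix (f : CrossedProduct α) : CStarMatrix G G A :=
  CStarMatrix.ofMatrix fun p q => α p⁻¹ (f (p * q⁻¹))

lemma toMatrix_apply (f : CrossedProduct α) (p q : G) :
    toMatrix f p q = α p⁻¹ (f (p * q⁻¹)) := rfl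

lemma toMatrix_injective : Function.Injective (toMatrix (α := α)) := by
  intro f h H
  ext g
  have := congrFun (congrFun H 1) g⁻¹
  simpa [toMatrix_apply] using this

lemma toMatrix_zero : toMatrix (0 : CrossedProduct α) = 0 := by
  ext p q; simp [toMatrix_apply]

lemma toMatrix_add (f h : CrossedProduct α) : toMatrix (f + h) = toMatrix f + toMatrix h := by
  ext p q; simp [toMatrix_apply]

lemma toMatrix_neg (f : CrossedProduct α) : toMatrix (-f) = -toMatrix f := by
  ext p q; simp [toMatrix_apply]

lemma toMatrix_sub (f h : CrossedProduct α) : toMatrix (f - h) = toMatrix f - toMatrix h := by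
  ext p q; simp [toMatrix_apply]

lemma toMatrix_smul (c : ℂ) (f : CrossedProduct α) : toMatrix (c • f) = c • toMatrix f := by
  ext p q; simp [toMatrix_apply, map_smul]

lemma toMatrix_star (f : CrossedProduct α) : toMatrix (star f) = star (toMatrix f) := by
  ext p q
  rw [CStarMatrix.star_apply, toMatrix_apply, toMatrix_apply, star_apply, ← map_star,
    ← StarAlgEquiv.mul_apply, ← map_mul]
  simp

lemma range_toMatrix : Set.range (toMatrix (α := α)) =
    {M : CStarMatrix G G A | ∀ p q, M p q = α p⁻¹ (M 1 (q * p⁻¹))} := by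
  ext M
  constructor
  · rintro ⟨f, rfl⟩ p q
    simp [toMatrix_apply]
  · intro h
    refine ⟨(fun g => M 1 g⁻¹ : G → A), ?_⟩
    ext p q
    rw [h p q]
    change α p⁻¹ (M 1 (p * q⁻¹)⁻¹) = _
    simp

variable [Fintype G]

/-- `(f h) (g) = ∑ p, f p * α_p (h (p⁻¹ g))`. -/
instance : Mul (CrossedProduct α) where
  mul f h := fun g => ∑ p, f p * α p (h (p⁻¹ * g))

lemma mul_apply (f h : CrossedProduct α) (g : G) :
    (f * h) g = ∑ p, f p * α p (h (p⁻¹ * g)) := rfl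

lemma toMatrix_mul (f h : CrossedProduct α) : toMatrix (f * h) = toMatrix f * toMatrix h := by
  ext p q
  rw [CStarMatrix.mul_apply, toMatrix_apply, mul_apply, map_sum]
  refine Fintype.sum_equiv ((Equiv.inv G).trans (Equiv.mulRight p)) _ _ fun s => ?_
  rw [toMatrix_apply, toMatrix_apply, map_mul, ← StarAlgEquiv.mul_apply, ← map_mul]
  simp [mul_assoc]

instance : NonUnitalRing (CrossedProduct α) where
  left_distrib a b c := toMatrix_injective (by
    simp only [toMatrix_mul, toMatrix_add, mul_add])
  right_distrib a b c := toMatrix_injective (by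
    simp only [toMatrix_mul, toMatrix_add, add_mul])
  zero_mul a := toMatrix_injective (by simp only [toMatrix_mul, toMatrix_zero, zero_mul])
  mul_zero a := toMatrix_injective (by simp only [toMatrix_mul, toMatrix_zero, mul_zero])
  mul_assoc a b c := toMatrix_injective (by simp only [toMatrix_mul, mul_assoc])

instance : StarRing (CrossedProduct α) where
  star_involutive a := toMatrix_injective (by simp only [toMatrix_star, star_star])
  star_mul a b := toMatrix_injective (by simp only [toMatrix_star, toMatrix_mul, star_mul])
  star_add a b := toMatrix_injective (by simp only [toMatrix_star, toMatrix_add, star_add])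

instance : IsScalarTower ℂ (CrossedProduct α) (CrossedProduct α) where
  smul_assoc c a b := toMatrix_injective (by
    simp only [smul_eq_mul, toMatrix_mul, toMatrix_smul, smul_mul_assoc])

instance : SMulCommClass ℂ (CrossedProduct α) (CrossedProduct α) where
  smul_comm c a b := toMatrix_injective (by
    simp only [smul_eq_mul, toMatrix_mul, toMatrix_smul, mul_smul_comm])

instance : StarModule ℂ (CrossedProduct α) where
  star_smul c a := toMatrix_injective (by simp only [toMatrix_star, toMatrix_smul, star_smul])

/-- The regular representation as a `*`-homomorphism into the C*-algebra of matrices over `A`. -/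
def regularRep (α : G →* (A ≃⋆ₐ[ℂ] A)) : CrossedProduct α →⋆ₙₐ[ℂ] CStarMatrix G G A where
  toFun := toMatrix
  map_zero' := toMatrix_zero
  map_add' := toMatrix_add
  map_mul' := toMatrix_mul
  map_smul' := toMatrix_smul
  map_star' := toMatrix_star

/-- The norm of the crossed product is the operator norm in the (faithful) regular
representation. -/
instance : NonUnitalNormedRing (CrossedProduct α) :=
  NonUnitalNormedRing.induced (CrossedProduct α) (CStarMatrix G G A) (regularRep α)
    toMatrix_injective

lemma norm_def (f : CrossedProduct α) : ‖f‖ = ‖toMatrix f‖ := rfl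

instance : NormedSpace ℂ (CrossedProduct α) where
  norm_smul_le c f := by rw [norm_def, norm_def, toMatrix_smul]; exact norm_smul_le _ _

instance : CStarRing (CrossedProduct α) where
  norm_mul_self_le f := by
    rw [norm_def, norm_def, toMatrix_mul, toMatrix_star, CStarRing.norm_star_mul_self]

lemma continuous_entry (p q : G) :
    Continuous fun M : CStarMatrix G G A => M p q :=
  AddMonoidHomClass.continuous_of_bound
    ({ toFun := fun M => M p q, map_zero' := rfl, map_add' := fun _ _ => rfl } :
      CStarMatrix G G A →+ A) 1
    (fun M => by rw [one_mul]; exact CStarMatrix.norm_entry_le_norm (M := M))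

instance : CompleteSpace (CrossedProduct α) := by
  have hi : IsUniformInducing (regularRep α) := ⟨rfl⟩
  refine hi.completeSpace (IsClosed.isComplete ?_)
  change IsClosed (Set.range (toMatrix (α := α)))
  rw [range_toMatrix]
  simp only [Set.ofPred_forall]
  exact isClosed_iInter fun p => isClosed_iInter fun q =>
    isClosed_eq (continuous_entry p q)
      ((StarAlgEquiv.isometry (α p⁻¹)).continuous.comp (continuous_entry 1 (q * p⁻¹)))

instance : NonUnitalCStarAlgebra (CrossedProduct α) where

/-- The norm dominates the norm of every `*`-homomorphism from the convolution algebra to a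
C*-algebra, so it is the norm of the universal C*-completion. -/
lemma norm_map_le {B : Type*} [NonUnitalCStarAlgebra B] (φ : CrossedProduct α →⋆ₙₐ[ℂ] B)
    (f : CrossedProduct α) : ‖φ f‖ ≤ ‖f‖ :=
  NonUnitalStarAlgHom.norm_apply_le φ f

end CrossedProduct

end CrossedProduct

/-! ### Closed two-sided ideals -/

section Ideals

variable {A : Type u} [NonUnitalCStarAlgebra A]

/-- A (not necessarily closed) two-sided ideal of an algebra. -/
def IsTwoSidedIdeal (I : Submodule ℂ A) : Prop :=
  ∀ a : A, ∀ x ∈ I, a * x ∈ I ∧ x * a ∈ I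

/-- An ideal `I` is essential if `a I = 0` implies `a = 0`. -/
def IsEssentialIdeal (I : Submodule ℂ A) : Prop :=
  ∀ a : A, (∀ x ∈ I, a * x = 0) → a = 0

variable (A) in
/-- A C*-algebra is prime if every nonzero two-sided ideal is essential. -/
def IsPrimeAlgebra : Prop :=
  ∀ I : Submodule ℂ A, IsTwoSidedIdeal I → I ≠ ⊥ → IsEssentialIdeal I

variable (A) in
/-- Closed essential two-sided ideals of a C*-algebra. -/
structure EssentialIdeal where
  carrier : Submodule ℂ A
  isTwoSided : IsTwoSidedIdeal carrier
  isClosed : IsClosed (carrier : Set A)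
  isEssential : IsEssentialIdeal carrier

namespace EssentialIdeal

instance : SetLike (EssentialIdeal A) A where
  coe I := I.carrier
  coe_injective I J h := by
    cases I; cases J; congr; exact SetLike.coe_injective h

lemma mem_carrier {I : EssentialIdeal A} {x : A} : x ∈ I.carrier ↔ x ∈ I := Iff.rfl

@[ext] lemma ext {I J : EssentialIdeal A} (h : ∀ x, x ∈ I ↔ x ∈ J) : I = J := SetLike.ext h

lemma mul_mem_left (I : EssentialIdeal A) (a : A) {x : A} (hx : x ∈ I) : a * x ∈ I :=
  (I.isTwoSided a x hx).1

lemma mul_mem_right (I : EssentialIdeal A) (a : A) {x : A} (hx : x ∈ I) : x * a ∈ I :=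
  (I.isTwoSided a x hx).2

instance : NonUnitalSubringClass (EssentialIdeal A) A where
  add_mem {I} _ _ hx hy := I.carrier.add_mem hx hy
  zero_mem I := I.carrier.zero_mem
  neg_mem {I} _ hx := I.carrier.neg_mem hx
  mul_mem {I} x _ _ hy := I.mul_mem_left x hy

instance : SMulMemClass (EssentialIdeal A) ℂ A where
  smul_mem {I} c _ hx := I.carrier.smul_mem c hx

lemma isClosed_coe (I : EssentialIdeal A) : IsClosed (I : Set A) := I.isClosed

/-- Ideals are ordered by inclusion. -/
instance : PartialOrder (EssentialIdeal A) := PartialOrder.ofSetLike (EssentialIdeal A) A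

end EssentialIdeal

/-- Every element of a C*-algebra is a limit `x u` for suitable elements `u`. -/
lemma mem_closure_mul (A : Type*) [NonUnitalCStarAlgebra A] (x : A) :
    x ∈ closure (Set.range fun u : A => x * u) := by
  let _ := CStarAlgebra.spectralOrder A
  have := CStarAlgebra.spectralOrderedRing A
  exact mem_closure_of_tendsto ((CStarAlgebra.increasingApproximateUnit A).tendsto_mul_left x)
    (Filter.Eventually.of_forall fun u => ⟨u, rfl⟩)

lemma mem_closure_mul' (A : Type*) [NonUnitalCStarAlgebra A] (x : A) :
    x ∈ closure (Set.range fun u : A => u * x) := by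
  let _ := CStarAlgebra.spectralOrder A
  have := CStarAlgebra.spectralOrderedRing A
  exact mem_closure_of_tendsto ((CStarAlgebra.increasingApproximateUnit A).tendsto_mul_right x)
    (Filter.Eventually.of_forall fun u => ⟨u, rfl⟩)

/-- The largest `*`-subalgebra contained in a closed ideal; only used to show that closed ideals are
self-adjoint. -/
def selfAdjointPart (I : EssentialIdeal A) : NonUnitalStarSubalgebra ℂ A where
  carrier := {x | x ∈ I ∧ star x ∈ I}
  add_mem' hx hy := ⟨add_mem hx.1 hy.1, by rw [star_add]; exact add_mem hx.2 hy.2⟩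
  zero_mem' := ⟨zero_mem I, by rw [star_zero]; exact zero_mem I⟩
  mul_mem' hx hy := ⟨mul_mem hx.1 hy.1, by rw [star_mul]; exact mul_mem hy.2 hx.2⟩
  smul_mem' c x hx := ⟨SMulMemClass.smul_mem c hx.1, by
    rw [star_smul]; exact SMulMemClass.smul_mem (star c) hx.2⟩
  star_mem' hx := ⟨hx.2, by rw [star_star]; exact hx.1⟩

/-- Closed two-sided ideals of a C*-algebra are self-adjoint. -/
lemma EssentialIdeal.star_mem (I : EssentialIdeal A) {x : A} (hx : x ∈ I) : star x ∈ I := by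
  have hc : IsClosed ((selfAdjointPart I : NonUnitalStarSubalgebra ℂ A) : Set A) :=
    I.isClosed_coe.inter (I.isClosed_coe.preimage continuous_star)
  let _ : NonUnitalCStarAlgebra (selfAdjointPart I) :=
    NonUnitalStarSubalgebra.nonUnitalCStarAlgebra _ (h_closed := hc)
  let _ := CStarAlgebra.spectralOrder (selfAdjointPart I)
  have := CStarAlgebra.spectralOrderedRing (selfAdjointPart I)
  have hu := CStarAlgebra.increasingApproximateUnit (selfAdjointPart I)
  let a : selfAdjointPart I := ⟨star x * x, I.mul_mem_left _ hx, by
    rw [star_mul, star_star]; exact I.mul_mem_left _ hx⟩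
  have h0 : Filter.Tendsto (fun u : selfAdjointPart I => 2 * ‖a - a * u‖)
      (CStarAlgebra.approximateUnit (selfAdjointPart I)) (𝓝 0) := by
    have := ((tendsto_const_nhds (x := a)).sub (hu.tendsto_mul_left a)).norm.const_mul 2
    simpa using this
  have h1 : Filter.Tendsto (fun u : selfAdjointPart I => ‖star x - (u : A) * star x‖ ^ 2)
      (CStarAlgebra.approximateUnit (selfAdjointPart I)) (𝓝 0) := by
    refine squeeze_zero' (Filter.Eventually.of_forall fun u => by positivity) ?_ h0
    filter_upwards [hu.eventually_norm, hu.eventually_star_eq] with u hu1 hu2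
    have hu2' : star (u : A) = u := congrArg Subtype.val hu2
    have e : star x - (u : A) * star x = star (x - x * u) := by
      rw [star_sub, star_mul, hu2']
    have e2 : star (x - x * (u : A)) * (x - x * u)
        = ((a - a * u : selfAdjointPart I) : A) - u * ((a - a * u : selfAdjointPart I) : A) := by
      change _ = (star x * x - star x * x * u) - u * (star x * x - star x * x * u)
      rw [star_sub, star_mul, hu2']
      noncomm_ring
    rw [e, norm_star, sq, ← CStarRing.norm_star_mul_self, e2]
    calc _ ≤ ‖((a - a * u : selfAdjointPart I) : A)‖
            + ‖(u : A) * ((a - a * u : selfAdjointPart I) : A)‖ := norm_sub_le _ _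
      _ ≤ ‖a - a * u‖ + ‖u‖ * ‖a - a * u‖ := by
        gcongr
        · exact le_rfl
        · exact norm_mul_le _ _
      _ ≤ 2 * ‖a - a * u‖ := by nlinarith [norm_nonneg (a - a * u)]
  have h2 : Filter.Tendsto (fun u : selfAdjointPart I => (u : A) * star x)
      (CStarAlgebra.approximateUnit (selfAdjointPart I)) (𝓝 (star x)) := by
    rw [tendsto_iff_norm_sub_tendsto_zero]
    have := h1.sqrt
    simpa [Real.sqrt_sq, norm_sub_rev] using this
  exact I.isClosed_coe.mem_of_tendsto h2
    (Filter.Eventually.of_forall fun u => I.mul_mem_right _ u.2.1)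

namespace EssentialIdeal

instance : StarMemClass (EssentialIdeal A) A where
  star_mem {I} _ hx := I.star_mem hx

/-- A closed ideal is a C*-algebra. -/
instance (I : EssentialIdeal A) : NonUnitalCStarAlgebra I :=
  NonUnitalStarSubalgebra.nonUnitalCStarAlgebra I (h_closed := I.isClosed_coe)

/-- The whole algebra, as an essential ideal of itself. -/
instance : Top (EssentialIdeal A) where
  top :=
    { carrier := ⊤
      isTwoSided := fun _ _ _ => ⟨trivial, trivial⟩
      isClosed := isClosed_univ
      isEssential := fun a h => by
        have h' := h (star a) trivial
        rwa [CStarRing.mul_star_self_eq_zero_iff] at h' }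

lemma mem_top (x : A) : x ∈ (⊤ : EssentialIdeal A) := trivial

/-- The intersection of two essential ideals is essential. -/
instance : Min (EssentialIdeal A) where
  min I J :=
    { carrier := I.carrier ⊓ J.carrier
      isTwoSided := fun a x hx => ⟨⟨I.mul_mem_left a hx.1, J.mul_mem_left a hx.2⟩,
        ⟨I.mul_mem_right a hx.1, J.mul_mem_right a hx.2⟩⟩
      isClosed := I.isClosed.inter J.isClosed
      isEssential := fun a h => I.isEssential a fun x hx => J.isEssential _ fun y hy => by
        rw [mul_assoc]
        exact h _ ⟨I.mul_mem_right y hx, J.mul_mem_left x hy⟩ }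

lemma min_le_left' (I J : EssentialIdeal A) : min I J ≤ I := fun _ hx => hx.1

lemma min_le_right' (I J : EssentialIdeal A) : min I J ≤ J := fun _ hx => hx.2

instance : Nonempty (EssentialIdeal A)ᵒᵈ := ⟨OrderDual.toDual ⊤⟩

/-- Under reverse inclusion the essential ideals are directed. -/
instance : IsDirectedOrder (EssentialIdeal A)ᵒᵈ where
  directed I J := ⟨OrderDual.toDual (min (OrderDual.ofDual I) (OrderDual.ofDual J)),
    min_le_left' _ _, min_le_right' _ _⟩

end EssentialIdeal

/-! ### Restriction of multipliers to a smaller ideal -/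

variable {I J K : EssentialIdeal A}

lemma multiplier_fst_mul (m : 𝓜(ℂ, A)) (x y : A) : m.fst (x * y) = m.fst x * y := by
  have h : ∀ z : A, z * (m.fst (x * y) - m.fst x * y) = 0 := fun z => by
    rw [mul_sub, ← m.central, ← mul_assoc, ← mul_assoc, ← m.central, sub_self]
  have := h (star (m.fst (x * y) - m.fst x * y))
  rwa [CStarRing.star_mul_self_eq_zero_iff, sub_eq_zero] at this

lemma multiplier_snd_mul (m : 𝓜(ℂ, A)) (x y : A) : m.snd (x * y) = x * m.snd y := by
  have h : ∀ z : A, (m.snd (x * y) - x * m.snd y) * z = 0 := fun z => by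
    rw [sub_mul, m.central, mul_assoc, mul_assoc, m.central, sub_self]
  have := h (star (m.snd (x * y) - x * m.snd y))
  rwa [CStarRing.mul_star_self_eq_zero_iff, sub_eq_zero] at this

/-- The inclusion of a smaller ideal. -/
def inclusion (h : I ≤ J) (x : I) : J := ⟨x, h x.2⟩

@[simp] lemma coe_inclusion (h : I ≤ J) (x : I) : (inclusion h x : A) = x := rfl

lemma continuous_inclusion (h : I ≤ J) : Continuous (inclusion h) :=
  continuous_subtype_val.subtype_mk _

/-- Multipliers of an ideal leave smaller ideals invariant. -/
lemma multiplier_fst_mem (h : I ≤ J) (m : 𝓜(ℂ, J)) (x : I) :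
    (m.fst (inclusion h x) : A) ∈ I := by
  have hc : IsClosed {y : I | (m.fst (inclusion h y) : A) ∈ I} :=
    I.isClosed_coe.preimage
      (continuous_subtype_val.comp (m.fst.continuous.comp (continuous_inclusion h)))
  refine hc.closure_subset_iff.2 ?_ (mem_closure_mul I x)
  rintro _ ⟨u, rfl⟩
  have e : inclusion h (x * u) = inclusion h x * inclusion h u := rfl
  change (m.fst (inclusion h (x * u)) : A) ∈ I
  rw [e, multiplier_fst_mul]
  exact I.mul_mem_left _ u.2

lemma multiplier_snd_mem (h : I ≤ J) (m : 𝓜(ℂ, J)) (x : I) :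
    (m.snd (inclusion h x) : A) ∈ I := by
  have hc : IsClosed {y : I | (m.snd (inclusion h y) : A) ∈ I} :=
    I.isClosed_coe.preimage
      (continuous_subtype_val.comp (m.snd.continuous.comp (continuous_inclusion h)))
  refine hc.closure_subset_iff.2 ?_ (mem_closure_mul' I x)
  rintro _ ⟨u, rfl⟩
  have e : inclusion h (u * x) = inclusion h u * inclusion h x := rfl
  change (m.snd (inclusion h (u * x)) : A) ∈ I
  rw [e, multiplier_snd_mul]
  exact I.mul_mem_right _ u.2

/-- A bounded operator on `J` leaving the smaller ideal `I` invariant, restricted to `I`. -/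
def restrictCLM (h : I ≤ J) (T : J →L[ℂ] J) (hT : ∀ x : I, (T (inclusion h x) : A) ∈ I) :
    I →L[ℂ] I where
  toFun x := ⟨T (inclusion h x), hT x⟩
  map_add' x y := Subtype.ext (congrArg (fun z : J => (z : A))
    (map_add T (inclusion h x) (inclusion h y)) :)
  map_smul' c x := Subtype.ext
    (congrArg (fun z : J => (z : A)) (map_smul T c (inclusion h x)) :)
  cont := (continuous_subtype_val.comp
    (T.continuous.comp (continuous_inclusion h))).subtype_mk _

/-- The restriction to `I` of a multiplier of `J ⊇ I`. -/
def restrictMultiplier (h : I ≤ J) (m : 𝓜(ℂ, J)) : 𝓜(ℂ, I) where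
  fst := restrictCLM h m.fst (multiplier_fst_mem h m)
  snd := restrictCLM h m.snd (multiplier_snd_mem h m)
  central x y := Subtype.ext
    (congrArg (fun z : J => (z : A)) (m.central (inclusion h x) (inclusion h y)) :)

@[simp] lemma restrictMultiplier_fst (h : I ≤ J) (m : 𝓜(ℂ, J)) (x : I) :
    ((restrictMultiplier h m).fst x : A) = m.fst (inclusion h x) := rfl

@[simp] lemma restrictMultiplier_snd (h : I ≤ J) (m : 𝓜(ℂ, J)) (x : I) :
    ((restrictMultiplier h m).snd x : A) = m.snd (inclusion h x) := rfl

/-- The canonical embedding `M(J) → M(I)` for essential ideals `I ⊆ J`. -/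
def restrict (h : I ≤ J) : 𝓜(ℂ, J) →⋆ₐ[ℂ] 𝓜(ℂ, I) where
  toFun := restrictMultiplier h
  map_one' := multiplier_ext (fun _ => rfl) (fun _ => rfl)
  map_mul' _ _ := multiplier_ext (fun _ => rfl) (fun _ => rfl)
  map_zero' := multiplier_ext (fun _ => rfl) (fun _ => rfl)
  map_add' _ _ := multiplier_ext (fun _ => rfl) (fun _ => rfl)
  commutes' _ := multiplier_ext (fun _ => rfl) (fun _ => rfl)
  map_star' _ := multiplier_ext (fun _ => rfl) (fun _ => rfl)

@[simp] lemma restrict_fst (h : I ≤ J) (m : 𝓜(ℂ, J)) (x : I) :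
    ((restrict h m).fst x : A) = m.fst (inclusion h x) := rfl

@[simp] lemma restrict_snd (h : I ≤ J) (m : 𝓜(ℂ, J)) (x : I) :
    ((restrict h m).snd x : A) = m.snd (inclusion h x) := rfl

lemma restrict_injective (h : I ≤ J) : Function.Injective (restrict h) := by
  rw [injective_iff_map_eq_zero]
  intro m hm
  have h1 : ∀ x : J, m.fst x = 0 := fun x => Subtype.ext (I.isEssential _ fun y hy => by
    have e : x * inclusion h ⟨y, hy⟩ = inclusion h ⟨(x : A) * y, I.mul_mem_left _ hy⟩ := rfl
    have e2 := congrArg Subtype.val (multiplier_fst_mul m x (inclusion h ⟨y, hy⟩))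
    rw [e, ← restrict_fst, hm] at e2
    exact e2.symm)
  refine multiplier_ext h1 fun x => ?_
  have h2 := m.central x (star (m.snd x))
  rw [h1, mul_zero, CStarRing.mul_star_self_eq_zero_iff] at h2
  exact h2

lemma norm_restrict (h : I ≤ J) (m : 𝓜(ℂ, J)) : ‖restrict h m‖ = ‖m‖ :=
  NonUnitalStarAlgHom.norm_map (restrict h) (restrict_injective h) m

end Ideals

/-! ### The algebra of local multipliers -/

section Completion

variable {B : Type*} [NormedRing B] [StarRing B] [CStarRing B] [NormedAlgebra ℂ B]
  [StarModule ℂ B]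

open UniformSpace

/-- The involution on the completion of a C*-normed algebra, extended by continuity. -/
instance completionStar : Star (Completion B) where
  star := Completion.map star

lemma completion_coe_star (x : B) : star (x : Completion B) = ((star x : B) : Completion B) :=
  Completion.map_coe star_isometry.uniformContinuous x

lemma completion_continuous_star : Continuous (star : Completion B → Completion B) :=
  Completion.continuous_map

instance completionStarRing : StarRing (Completion B) where
  star_involutive x := by
    induction x using Completion.induction_on with
    | hp =>
      exact isClosed_eq (completion_continuous_star.comp completion_continuous_star) continuous_id
    | ih x => simp only [completion_coe_star, star_star]
  star_mul x y := by
    induction x, y using Completion.induction_on₂ with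
    | hp =>
      exact isClosed_eq (completion_continuous_star.comp continuous_mul)
        ((completion_continuous_star.comp continuous_snd).mul
          (completion_continuous_star.comp continuous_fst))
    | ih x y => simp only [completion_coe_star, ← Completion.coe_mul, star_mul]
  star_add x y := by
    induction x, y using Completion.induction_on₂ with
    | hp =>
      exact isClosed_eq (completion_continuous_star.comp continuous_add)
        ((completion_continuous_star.comp continuous_fst).add
          (completion_continuous_star.comp continuous_snd))
    | ih x y => simp only [completion_coe_star, ← Completion.coe_add, star_add]

instance completionCStarRing : CStarRing (Completion B) where
  norm_mul_self_le x := by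
    induction x using Completion.induction_on with
    | hp =>
      exact isClosed_le (continuous_norm.mul continuous_norm)
        (continuous_norm.comp (completion_continuous_star.mul continuous_id))
    | ih x =>
      simp only [completion_coe_star, ← Completion.coe_mul, Completion.norm_coe]
      exact CStarRing.norm_mul_self_le x

instance completionStarModule : StarModule ℂ (Completion B) where
  star_smul c x := by
    induction x using Completion.induction_on with
    | hp =>
      exact isClosed_eq (completion_continuous_star.comp (continuous_const_smul c))
        (completion_continuous_star.const_smul (star c))
    | ih x => simp only [completion_coe_star, ← Completion.coe_smul, star_smul]

/-- The norm-completion of a C*-normed algebra is a C*-algebra. -/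
instance completionNormedAlgebra : NormedAlgebra ℂ (Completion B) where
  norm_smul_le c x := norm_smul_le c x

instance completionCStarAlgebra : CStarAlgebra (Completion B) where

end Completion

section LocalMultipliers

variable (A : Type u) [NonUnitalCStarAlgebra A]

/-- The family of multiplier algebras `M(I)`, indexed by the closed essential ideals ordered by
reverse inclusion. -/
abbrev multiplierFamily (I : (EssentialIdeal A)ᵒᵈ) : Type u :=
  𝓜(ℂ, (OrderDual.ofDual I : EssentialIdeal A))

/-- The connecting maps `M(J) → M(I)` for `I ⊆ J`. -/
def transition (J I : (EssentialIdeal A)ᵒᵈ) (h : J ≤ I) :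
    multiplierFamily A J →⋆ₐ[ℂ] multiplierFamily A I :=
  restrict (I := OrderDual.ofDual I) (J := OrderDual.ofDual J) h

instance : DirectedSystem (multiplierFamily A) (transition A · · ·) where
  map_self _ _ := multiplier_ext (fun _ => rfl) (fun _ => rfl)
  map_map _ _ _ _ _ _ := multiplier_ext (fun _ => rfl) (fun _ => rfl)

/-- The algebraic direct limit of the multiplier algebras of the closed essential ideals. -/
def PreLocalMultipliers : Type u := DirectLimit (multiplierFamily A) (transition A)

namespace PreLocalMultipliers

instance : Ring (PreLocalMultipliers A) :=
  inferInstanceAs (Ring (DirectLimit (multiplierFamily A) (transition A)))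

instance : Algebra ℂ (PreLocalMultipliers A) :=
  inferInstanceAs (Algebra ℂ (DirectLimit (multiplierFamily A) (transition A)))

instance : Star (PreLocalMultipliers A) :=
  inferInstanceAs (Star (DirectLimit (multiplierFamily A) (transition A)))

variable {A}

/-- The class of a multiplier `m` of the essential ideal `I`. -/
def mk (I : EssentialIdeal A) (m : 𝓜(ℂ, I)) : PreLocalMultipliers A :=
  (⟦⟨OrderDual.toDual I, m⟩⟧ : DirectLimit (multiplierFamily A) (transition A))

lemma mk_restrict {I J : EssentialIdeal A} (h : I ≤ J) (m : 𝓜(ℂ, J)) :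
    mk I (restrict h m) = mk J m := by
  have := DirectLimit.eq_of_le (f := transition A)
    (⟨OrderDual.toDual J, m⟩ : Σ I, multiplierFamily A I) (OrderDual.toDual I) h
  exact this.symm

lemma mk_congr {I J : EssentialIdeal A} (h : I ≤ J) {n : 𝓜(ℂ, I)} {m : 𝓜(ℂ, J)}
    (h₁ : ∀ x, (n.fst x : A) = m.fst (inclusion h x))
    (h₂ : ∀ x, (n.snd x : A) = m.snd (inclusion h x)) : mk I n = mk J m := by
  rw [← mk_restrict h]
  exact congrArg (mk I) (multiplier_ext (fun x => Subtype.ext (h₁ x)) (fun x => Subtype.ext (h₂ x)))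

lemma mk_add (I : EssentialIdeal A) (m n : 𝓜(ℂ, I)) : mk I m + mk I n = mk I (m + n) :=
  DirectLimit.add_def ..

lemma mk_mul (I : EssentialIdeal A) (m n : 𝓜(ℂ, I)) : mk I m * mk I n = mk I (m * n) :=
  DirectLimit.mul_def ..

lemma mk_star (I : EssentialIdeal A) (m : 𝓜(ℂ, I)) : star (mk I m) = mk I (star m) :=
  DirectLimit.star_def ..

lemma mk_smul (I : EssentialIdeal A) (c : ℂ) (m : 𝓜(ℂ, I)) : c • mk I m = mk I (c • m) :=
  DirectLimit.smul_def ..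

lemma mk_zero (I : EssentialIdeal A) : mk I 0 = 0 :=
  (DirectLimit.zero_def (f := transition A) (OrderDual.toDual I)).symm

lemma mk_one (I : EssentialIdeal A) : mk I 1 = 1 :=
  (DirectLimit.one_def (f := transition A) (OrderDual.toDual I)).symm

lemma induction {C : PreLocalMultipliers A → Prop} (h : ∀ I m, C (mk I m))
    (x : PreLocalMultipliers A) : C x :=
  DirectLimit.induction (f := transition A) (C := C) (fun I m => h (OrderDual.ofDual I) m) x

lemma induction₂ {C : PreLocalMultipliers A → PreLocalMultipliers A → Prop}
    (h : ∀ I m n, C (mk I m) (mk I n)) (x y : PreLocalMultipliers A) : C x y :=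
  DirectLimit.induction₂ (f := transition A) (C := C)
    (fun I m n => h (OrderDual.ofDual I) m n) x y

instance : StarRing (PreLocalMultipliers A) where
  star_involutive := induction fun I m => by rw [mk_star, mk_star, star_star]
  star_mul := induction₂ fun I m n => by
    rw [mk_mul, mk_star, mk_star, mk_star, mk_mul, star_mul]
  star_add := induction₂ fun I m n => by
    rw [mk_add, mk_star, mk_star, mk_star, mk_add, star_add]

instance : StarModule ℂ (PreLocalMultipliers A) where
  star_smul c := induction fun I m => by
    rw [mk_smul, mk_star, mk_star, mk_smul, star_smul]

/-- The norm of the class of `m` is the norm of `m`; the connecting maps are isometric. -/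
instance : Norm (PreLocalMultipliers A) where
  norm := DirectLimit.lift (transition A) (fun _ m => ‖m‖) (fun _ _ h m => (norm_restrict h m).symm)

lemma norm_mk (I : EssentialIdeal A) (m : 𝓜(ℂ, I)) : ‖mk I m‖ = ‖m‖ := rfl

lemma normCore : NormedSpace.Core ℂ (PreLocalMultipliers A) where
  norm_nonneg := induction fun I m => by rw [norm_mk]; exact norm_nonneg m
  norm_smul c := induction fun I m => by rw [mk_smul, norm_mk, norm_mk, norm_smul]
  norm_triangle := induction₂ fun I m n => by
    rw [mk_add, norm_mk, norm_mk, norm_mk]; exact norm_add_le m n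
  norm_eq_zero_iff := induction fun I m => by
    rw [norm_mk, norm_eq_zero]
    refine ⟨fun h => by rw [h, mk_zero], fun h => ?_⟩
    rw [← norm_eq_zero, ← norm_mk, h, ← mk_zero I, norm_mk, norm_zero]

instance : NormedAddCommGroup (PreLocalMultipliers A) := NormedAddCommGroup.ofCore normCore

instance : NormedRing (PreLocalMultipliers A) where
  __ := (inferInstance : Ring (PreLocalMultipliers A))
  __ := (inferInstance : NormedAddCommGroup (PreLocalMultipliers A))
  norm_mul_le := induction₂ fun I m n => by
    rw [mk_mul, norm_mk, norm_mk, norm_mk]; exact norm_mul_le m n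

instance : NormedAlgebra ℂ (PreLocalMultipliers A) where
  norm_smul_le c x := (normCore.norm_smul c x).le

instance : CStarRing (PreLocalMultipliers A) where
  norm_mul_self_le := induction fun I m => by
    rw [mk_star, mk_mul, norm_mk, norm_mk]; exact CStarRing.norm_mul_self_le m

end PreLocalMultipliers

/-- The algebra of local multipliers of `A`: the C*-algebraic inductive limit (that is, the
completion of the algebraic direct limit) of the multiplier algebras `M(I)`, where `I` runs through
the closed essential ideals of `A`. -/
def LocalMultipliers : Type u := UniformSpace.Completion (PreLocalMultipliers A)

instance : CStarAlgebra (LocalMultipliers A) :=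
  inferInstanceAs (CStarAlgebra (UniformSpace.Completion (PreLocalMultipliers A)))

namespace LocalMultipliers

variable {A}

/-- The canonical embedding of the algebraic direct limit. -/
def ofPre : PreLocalMultipliers A →⋆ₐ[ℂ] LocalMultipliers A where
  toFun x := (x : UniformSpace.Completion (PreLocalMultipliers A))
  map_one' := UniformSpace.Completion.coe_one _
  map_mul' x y := UniformSpace.Completion.coe_mul x y
  map_zero' := UniformSpace.Completion.coe_zero
  map_add' x y := UniformSpace.Completion.coe_add x y
  commutes' _ := rfl
  map_star' x := (completion_coe_star x).symm

lemma norm_ofPre (x : PreLocalMultipliers A) : ‖ofPre x‖ = ‖x‖ :=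
  UniformSpace.Completion.norm_coe x

lemma isometry_ofPre : Isometry (ofPre : PreLocalMultipliers A → LocalMultipliers A) :=
  UniformSpace.Completion.coe_isometry

lemma denseRange_ofPre : DenseRange (ofPre : PreLocalMultipliers A → LocalMultipliers A) :=
  UniformSpace.Completion.denseRange_coe

/-- The canonical embedding `M(I) → M_loc(A)` for an essential ideal `I`. -/
def ofMultiplier (I : EssentialIdeal A) : 𝓜(ℂ, I) →⋆ₐ[ℂ] LocalMultipliers A where
  toFun m := ofPre (PreLocalMultipliers.mk I m)
  map_one' := by rw [PreLocalMultipliers.mk_one, map_one]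
  map_mul' m n := by rw [← PreLocalMultipliers.mk_mul, map_mul]
  map_zero' := by rw [PreLocalMultipliers.mk_zero, map_zero]
  map_add' m n := by rw [← PreLocalMultipliers.mk_add, map_add]
  commutes' c := by
    rw [Algebra.algebraMap_eq_smul_one, ← PreLocalMultipliers.mk_smul, map_smul,
      PreLocalMultipliers.mk_one, map_one, Algebra.algebraMap_eq_smul_one]
  map_star' m := by rw [← PreLocalMultipliers.mk_star, map_star]

/-- The canonical embedding `A → M_loc(A)`; an element `a` acts on the essential ideal `A`
by left and right multiplication. -/
def of (a : A) : LocalMultipliers A :=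
  ofMultiplier ⊤ (((⟨a, EssentialIdeal.mem_top a⟩ : (⊤ : EssentialIdeal A)) :
    𝓜(ℂ, (⊤ : EssentialIdeal A))))

end LocalMultipliers

end LocalMultipliers

/-! ### The extension of an action to the algebra of local multipliers -/

section Functoriality

variable {A B C : Type*} [NonUnitalCStarAlgebra A] [NonUnitalCStarAlgebra B]
  [NonUnitalCStarAlgebra C]

/-- The image `e(I)` of an essential ideal under a `*`-isomorphism. -/
def EssentialIdeal.map (e : A ≃⋆ₐ[ℂ] B) (I : EssentialIdeal A) : EssentialIdeal B where
  carrier := I.carrier.comap (equivCLM e.symm).toLinearMap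
  isTwoSided a x hx := by
    have h := I.isTwoSided (e.symm a) (e.symm x) hx
    rw [← map_mul, ← map_mul] at h
    exact h
  isClosed := I.isClosed.preimage (equivCLM e.symm).continuous
  isEssential a h := by
    apply e.symm.injective
    rw [map_zero]
    refine I.isEssential _ fun x hx => ?_
    have h' := congrArg e.symm (h (e x) (by
      change e.symm (e x) ∈ I.carrier
      rwa [StarAlgEquiv.symm_apply_apply]))
    rwa [map_mul, map_zero, StarAlgEquiv.symm_apply_apply] at h'

lemma EssentialIdeal.mem_map {e : A ≃⋆ₐ[ℂ] B} {I : EssentialIdeal A} {x : B} :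
    x ∈ I.map e ↔ e.symm x ∈ I := Iff.rfl

lemma EssentialIdeal.apply_mem_map (e : A ≃⋆ₐ[ℂ] B) {I : EssentialIdeal A} {x : A} (hx : x ∈ I) :
    e x ∈ I.map e := by
  rwa [EssentialIdeal.mem_map, StarAlgEquiv.symm_apply_apply]

/-- The restriction `I ≃ e(I)` of a `*`-isomorphism `e`. -/
def idealEquiv (e : A ≃⋆ₐ[ℂ] B) (I : EssentialIdeal A) : I ≃⋆ₐ[ℂ] I.map e where
  toFun x := ⟨e x, EssentialIdeal.apply_mem_map e x.2⟩
  invFun y := ⟨e.symm y, y.2⟩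
  left_inv x := Subtype.ext (e.symm_apply_apply x)
  right_inv y := Subtype.ext (e.apply_symm_apply y)
  map_mul' x y := Subtype.ext (map_mul e (x : A) y)
  map_add' x y := Subtype.ext (map_add e (x : A) y)
  map_star' x := Subtype.ext (map_star e (x : A))
  map_smul' c x := Subtype.ext (map_smul e c (x : A))

namespace PreLocalMultipliers

/-- The map of algebraic direct limits given by the isomorphisms `M(I) ≃ M(e(I))`. -/
def map (e : A ≃⋆ₐ[ℂ] B) : PreLocalMultipliers A → PreLocalMultipliers B :=
  DirectLimit.lift (transition A)
    (fun I m => mk ((OrderDual.ofDual I).map e) (multiplierEquiv (idealEquiv e _) m))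
    (fun J I h m => (mk_congr
      (I := (OrderDual.ofDual I).map e) (J := (OrderDual.ofDual J).map e)
      (n := multiplierEquiv (idealEquiv e _) (transition A J I h m))
      (m := multiplierEquiv (idealEquiv e _) m)
      (fun _ hx => h hx) (fun _ => rfl) (fun _ => rfl)).symm)

lemma map_mk (e : A ≃⋆ₐ[ℂ] B) (I : EssentialIdeal A) (m : 𝓜(ℂ, I)) :
    map e (mk I m) = mk (I.map e) (multiplierEquiv (idealEquiv e I) m) := rfl

lemma map_refl (x : PreLocalMultipliers A) : map (StarAlgEquiv.refl ℂ A) x = x := by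
  induction x using induction with
  | h I m =>
    rw [map_mk]
    exact mk_congr (fun _ hx => hx) (fun _ => rfl) (fun _ => rfl)

lemma map_trans (e : A ≃⋆ₐ[ℂ] B) (f : B ≃⋆ₐ[ℂ] C) (x : PreLocalMultipliers A) :
    map (e.trans f) x = map f (map e x) := by
  induction x using induction with
  | h I m =>
    rw [map_mk, map_mk, map_mk]
    exact mk_congr (fun _ hx => hx) (fun _ => rfl) (fun _ => rfl)

lemma map_add' (e : A ≃⋆ₐ[ℂ] B) (x y : PreLocalMultipliers A) :
    map e (x + y) = map e x + map e y := by
  induction x, y using induction₂ with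
  | h I m n => rw [mk_add, map_mk, map_mk, map_mk, mk_add, map_add]

lemma map_mul' (e : A ≃⋆ₐ[ℂ] B) (x y : PreLocalMultipliers A) :
    map e (x * y) = map e x * map e y := by
  induction x, y using induction₂ with
  | h I m n => rw [mk_mul, map_mk, map_mk, map_mk, mk_mul, map_mul]

lemma map_star' (e : A ≃⋆ₐ[ℂ] B) (x : PreLocalMultipliers A) :
    map e (star x) = star (map e x) := by
  induction x using induction with
  | h I m => rw [mk_star, map_mk, map_mk, mk_star, map_star]

lemma map_smul' (e : A ≃⋆ₐ[ℂ] B) (c : ℂ) (x : PreLocalMultipliers A) :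
    map e (c • x) = c • map e x := by
  induction x using induction with
  | h I m => rw [mk_smul, map_mk, map_mk, mk_smul, map_smul]

lemma norm_map (e : A ≃⋆ₐ[ℂ] B) (x : PreLocalMultipliers A) : ‖map e x‖ = ‖x‖ := by
  induction x using induction with
  | h I m => rw [map_mk, norm_mk, norm_mk, StarAlgEquiv.norm_map]

lemma uniformContinuous_map (e : A ≃⋆ₐ[ℂ] B) : UniformContinuous (map e) :=
  (AddMonoidHomClass.isometry_of_norm (AddMonoidHom.mk' (map e) (map_add' e))
    (norm_map e)).uniformContinuous

end PreLocalMultipliers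

namespace LocalMultipliers

open UniformSpace

/-- The extension by continuity of `PreLocalMultipliers.map`. -/
def map (e : A ≃⋆ₐ[ℂ] B) : LocalMultipliers A → LocalMultipliers B :=
  Completion.map (PreLocalMultipliers.map e)

lemma continuous_map (e : A ≃⋆ₐ[ℂ] B) : Continuous (map e) := Completion.continuous_map

lemma map_ofPre (e : A ≃⋆ₐ[ℂ] B) (x : PreLocalMultipliers A) :
    map e (ofPre x) = ofPre (PreLocalMultipliers.map e x) :=
  Completion.map_coe (PreLocalMultipliers.uniformContinuous_map e) x

lemma induction_on {p : LocalMultipliers A → Prop} (x : LocalMultipliers A)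
    (hp : IsClosed {x | p x}) (ih : ∀ x, p (ofPre x)) : p x :=
  Completion.induction_on x hp ih

lemma induction_on₂ {p : LocalMultipliers A → LocalMultipliers A → Prop} (x y : LocalMultipliers A)
    (hp : IsClosed {z : LocalMultipliers A × LocalMultipliers A | p z.1 z.2})
    (ih : ∀ x y, p (ofPre x) (ofPre y)) : p x y :=
  Completion.induction_on₂ x y hp ih

lemma map_refl (x : LocalMultipliers A) : map (StarAlgEquiv.refl ℂ A) x = x := by
  refine induction_on (p := fun x => map (StarAlgEquiv.refl ℂ A) x = x) x
    (isClosed_eq (continuous_map _) continuous_id) fun x => ?_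
  rw [map_ofPre, PreLocalMultipliers.map_refl]

lemma map_trans (e : A ≃⋆ₐ[ℂ] B) (f : B ≃⋆ₐ[ℂ] C) (x : LocalMultipliers A) :
    map (e.trans f) x = map f (map e x) := by
  refine induction_on (p := fun x => map (e.trans f) x = map f (map e x)) x
    (isClosed_eq (continuous_map _) ((continuous_map f).comp (continuous_map e))) fun x => ?_
  rw [map_ofPre, map_ofPre, map_ofPre, PreLocalMultipliers.map_trans]

/-- The `*`-isomorphism `M_loc(A) ≃ M_loc(B)` induced by a `*`-isomorphism `e : A ≃ B`: it is the
continuous map which on each `M(I)` is the canonical isomorphism `M(I) ≃ M(e(I))`. -/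
def equiv (e : A ≃⋆ₐ[ℂ] B) : LocalMultipliers A ≃⋆ₐ[ℂ] LocalMultipliers B where
  toFun := map e
  invFun := map e.symm
  left_inv x := by
    have h : e.trans e.symm = StarAlgEquiv.refl ℂ A :=
      StarAlgEquiv.ext fun a => e.symm_apply_apply a
    rw [← map_trans, h, map_refl]
  right_inv x := by
    have h : e.symm.trans e = StarAlgEquiv.refl ℂ B :=
      StarAlgEquiv.ext fun a => e.apply_symm_apply a
    rw [← map_trans, h, map_refl]
  map_mul' x y := by
    refine induction_on₂ (p := fun x y => map e (x * y) = map e x * map e y) x y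
      (isClosed_eq ((continuous_map e).comp continuous_mul)
      (((continuous_map e).comp continuous_fst).mul ((continuous_map e).comp continuous_snd)))
      fun x y => ?_
    rw [← map_mul, map_ofPre, map_ofPre, map_ofPre, PreLocalMultipliers.map_mul', map_mul]
  map_add' x y := by
    refine induction_on₂ (p := fun x y => map e (x + y) = map e x + map e y) x y
      (isClosed_eq ((continuous_map e).comp continuous_add)
      (((continuous_map e).comp continuous_fst).add ((continuous_map e).comp continuous_snd)))
      fun x y => ?_
    rw [← map_add, map_ofPre, map_ofPre, map_ofPre, PreLocalMultipliers.map_add', map_add]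
  map_star' x := by
    refine induction_on (p := fun x => map e (star x) = star (map e x)) x
      (isClosed_eq ((continuous_map e).comp continuous_star)
      (continuous_star.comp (continuous_map e))) fun x => ?_
    rw [← map_star, map_ofPre, map_ofPre, PreLocalMultipliers.map_star', map_star]
  map_smul' c x := by
    refine induction_on (p := fun x => map e (c • x) = c • map e x) x
      (isClosed_eq ((continuous_map e).comp (continuous_const_smul c))
      ((continuous_map e).const_smul c)) fun x => ?_
    rw [← map_smul, map_ofPre, map_ofPre, PreLocalMultipliers.map_smul', map_smul]

lemma equiv_ofMultiplier (e : A ≃⋆ₐ[ℂ] B) (I : EssentialIdeal A) (m : 𝓜(ℂ, I)) :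
    equiv e (ofMultiplier I m) = ofMultiplier (I.map e) (multiplierEquiv (idealEquiv e I) m) :=
  map_ofPre e (PreLocalMultipliers.mk I m)

end LocalMultipliers

/-- The canonical extension to `M_loc(A)` of an action of a group on `A`. -/
def localMultiplierAction {G : Type*} [Group G] (α : G →* (A ≃⋆ₐ[ℂ] A)) :
    G →* (LocalMultipliers A ≃⋆ₐ[ℂ] LocalMultipliers A) where
  toFun g := LocalMultipliers.equiv (α g)
  map_one' := StarAlgEquiv.ext fun x => by
    rw [map_one]
    exact LocalMultipliers.map_refl x
  map_mul' g h := StarAlgEquiv.ext fun x => by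
    rw [map_mul]
    exact LocalMultipliers.map_trans (α h) (α g) x

/-- The action `α` on `A` is properly outer if no `α_g` with `g ≠ e` is implemented by a unitary
element of `M_loc(A)`. -/
def IsProperlyOuter {G : Type*} [Group G] (α : G →* (A ≃⋆ₐ[ℂ] A)) : Prop :=
  ∀ g : G, g ≠ 1 → ¬ ∃ u ∈ unitary (LocalMultipliers A),
    ∀ a : A, LocalMultipliers.of (α g a) = u * LocalMultipliers.of a * star u

end Functoriality

end CStarDyn

end

open CStarDyn

/-! Write `a δ_t` for the function with value `a` at `t` and zero elsewhere.

For a), `A ⋊ G` is an ideal of `M(A) ⋊ G`, so the larger algebra acts on it by multipliers.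
Coefficients can be read off from this action, because the value at `g` of `(a δ_1) F` is `a F(g)`;
this gives injectivity. For surjectivity, the same formula applied to an arbitrary multiplier of `A
⋊ G` defines its coefficients in `M(A)`. Approximate units are not needed: an element `y` of a
C*-algebra is determined by the products `x y`.

For b), the main point is that every nonzero ideal `J` of `A ⋊ G` meets `A`
(`exists_single_one_mem`). Take a nonzero `f ∈ J` of minimal support, translated so that `f(1) ≠ 0`.
If `f(g) ≠ 0` for some `g ≠ 1`, minimality makes `x(1) ↦ x(g)`, for `x ∈ J` supported in the support
of `f`, a well-defined injective map `φ` between nonzero ideals of `A`. It is left `A`-linear and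
satisfies `φ(c x) = φ(c) α_g(x)`. Primeness forces `φ(c) φ(d)* = r c d*` with a scalar `r > 0`
(`IsTwistedGraph.exists_scalar`). After division by `√r` and closure, `φ` becomes right
multiplication by the adjoint of a unitary multiplier of an essential ideal, and this unitary
implements `α_g` (`IsTwistedGraph.exists_unitary`). Proper outerness excludes this, so `f = f(1)
δ_1`.

Hence every essential ideal `J` of `A ⋊ G` contains `I ⋊ G` for an invariant essential ideal `I` of
`A`, and a) applied to `I` gives isometric embeddings `M(J) → M(I ⋊ G) = M(I) ⋊ G → M_loc(A) ⋊ G`.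
They are compatible with restriction, so they pass to the inductive limit. The range is dense
because an element of `M_loc(A) ⋊ G` has finitely many coefficients, which can be approximated on
one common invariant ideal. -/

noncomputable section

namespace CStarDyn

universe u v

/-! ### Multipliers coming from an ambient algebra -/

section Idealizer

variable {B D : Type*} [NonUnitalCStarAlgebra B] [NonUnitalCStarAlgebra D]

/-- The bounded operator `T` on `D` with `ι ∘ T = S ∘ ι`. -/
def liftCLM (ι : D →⋆ₙₐ[ℂ] B) (hι : Function.Injective ι) (S : B →L[ℂ] B)
    (hS : ∀ d, ∃ d', ι d' = S (ι d)) : D →L[ℂ] D :=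
  LinearMap.mkContinuous
    { toFun := fun d => (hS d).choose
      map_add' := fun x y => hι ((hS (x + y)).choose_spec.trans (by
        rw [map_add, map_add, map_add, (hS x).choose_spec, (hS y).choose_spec]))
      map_smul' := fun c x => hι ((hS (c • x)).choose_spec.trans (by
        rw [map_smul, map_smul, RingHom.id_apply, map_smul, (hS x).choose_spec])) }
    -- An injective `*`-homomorphism is isometric, so the bound for `S` passes to `D`.
    ‖S‖ (fun x => by
      change ‖(hS x).choose‖ ≤ _
      rw [← NonUnitalStarAlgHom.norm_map ι hι, (hS _).choose_spec,
        ← NonUnitalStarAlgHom.norm_map ι hι x]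
      exact S.le_opNorm _)

lemma map_liftCLM (ι : D →⋆ₙₐ[ℂ] B) (hι : Function.Injective ι) (S : B →L[ℂ] B)
    (hS : ∀ d, ∃ d', ι d' = S (ι d)) (d : D) : ι (liftCLM ι hι S hS d) = S (ι d) :=
  (hS d).choose_spec

/-- If `D` embeds as an ideal in `B`, then `B` acts on `D` by multipliers. -/
def toMultiplier (ι : D →⋆ₙₐ[ℂ] B) (hι : Function.Injective ι)
    (hl : ∀ b d, ∃ d', ι d' = b * ι d) (hr : ∀ b d, ∃ d', ι d' = ι d * b) (b : B) : 𝓜(ℂ, D) where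
  fst := liftCLM ι hι (ContinuousLinearMap.mul ℂ B b) (hl b)
  snd := liftCLM ι hι ((ContinuousLinearMap.mul ℂ B).flip b) (hr b)
  central x y := hι (by
    have h1 := map_liftCLM ι hι (ContinuousLinearMap.mul ℂ B b) (hl b) y
    have h2 := map_liftCLM ι hι ((ContinuousLinearMap.mul ℂ B).flip b) (hr b) x
    rw [map_mul, map_mul]
    exact (congrArg (· * ι y) h2).trans ((mul_assoc _ _ _).trans (congrArg (ι x * ·) h1.symm)))

variable (ι : D →⋆ₙₐ[ℂ] B) (hι : Function.Injective ι)
    (hl : ∀ b d, ∃ d', ι d' = b * ι d) (hr : ∀ b d, ∃ d', ι d' = ι d * b)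

lemma map_toMultiplier_fst (b : B) (d : D) :
    ι ((toMultiplier ι hι hl hr b).fst d) = b * ι d := map_liftCLM ι hι _ _ d

lemma map_toMultiplier_snd (b : B) (d : D) :
    ι ((toMultiplier ι hι hl hr b).snd d) = ι d * b := map_liftCLM ι hι _ _ d

/-- `toMultiplier` as a `*`-homomorphism. -/
def toMultiplierHom : B →⋆ₙₐ[ℂ] 𝓜(ℂ, D) where
  toFun := toMultiplier ι hι hl hr
  map_zero' := multiplier_ext
    (fun x => hι (by rw [map_toMultiplier_fst, zero_mul]; exact (map_zero ι).symm))
    (fun x => hι (by rw [map_toMultiplier_snd, mul_zero]; exact (map_zero ι).symm))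
  map_add' a b := multiplier_ext
    (fun x => hι (by
      rw [map_toMultiplier_fst, add_mul, ← map_toMultiplier_fst ι hι hl hr,
        ← map_toMultiplier_fst ι hι hl hr, ← map_add]; rfl))
    (fun x => hι (by
      rw [map_toMultiplier_snd, mul_add, ← map_toMultiplier_snd ι hι hl hr,
        ← map_toMultiplier_snd ι hι hl hr, ← map_add]; rfl))
  map_mul' a b := multiplier_ext
    (fun x => hι (by
      rw [map_toMultiplier_fst, mul_assoc, ← map_toMultiplier_fst ι hι hl hr b,
        ← map_toMultiplier_fst ι hι hl hr]; rfl))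
    (fun x => hι (by
      rw [map_toMultiplier_snd, ← mul_assoc, ← map_toMultiplier_snd ι hι hl hr a,
        ← map_toMultiplier_snd ι hι hl hr]; rfl))
  map_smul' c a := multiplier_ext
    (fun x => hι (by
      rw [map_toMultiplier_fst, smul_mul_assoc, ← map_toMultiplier_fst ι hι hl hr,
        ← map_smul]; rfl))
    (fun x => hι (by
      rw [map_toMultiplier_snd, mul_smul_comm, ← map_toMultiplier_snd ι hι hl hr,
        ← map_smul]; rfl))
  map_star' a := multiplier_ext
    (fun x => hι (by
      rw [map_toMultiplier_fst, DoubleCentralizer.star_fst, map_star, map_toMultiplier_snd,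
        star_mul, map_star, star_star]))
    (fun x => hι (by
      rw [map_toMultiplier_snd, DoubleCentralizer.star_snd, map_star, map_toMultiplier_fst,
        star_mul, map_star, star_star]))

lemma map_toMultiplierHom_fst (b : B) (d : D) :
    ι ((toMultiplierHom ι hι hl hr b).fst d) = b * ι d := map_liftCLM ι hι _ _ d

lemma map_toMultiplierHom_snd (b : B) (d : D) :
    ι ((toMultiplierHom ι hι hl hr b).snd d) = ι d * b := map_liftCLM ι hι _ _ d

lemma toMultiplierHom_coe (d : D) : toMultiplierHom ι hι hl hr (ι d) = (d : 𝓜(ℂ, D)) :=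
  multiplier_ext
    (fun x => hι (by rw [map_toMultiplierHom_fst, ← map_mul]; rfl))
    (fun x => hι (by rw [map_toMultiplierHom_snd, ← map_mul]; rfl))

end Idealizer

/-! ### Faithfulness of multiplication, and `A` as an ideal of `M(A)` -/

section Multipliers

variable {A : Type*} [NonUnitalCStarAlgebra A]

lemma eq_of_forall_mul_left {a b : A} (h : ∀ x, x * a = x * b) : a = b := by
  have := h (star (a - b))
  rw [← sub_eq_zero, ← mul_sub, CStarRing.star_mul_self_eq_zero_iff, sub_eq_zero] at this
  exact this

lemma eq_of_forall_mul_right {a b : A} (h : ∀ x, a * x = b * x) : a = b := by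
  have := h (star (a - b))
  rw [← sub_eq_zero, ← sub_mul, CStarRing.mul_star_self_eq_zero_iff, sub_eq_zero] at this
  exact this

/-- The identity `R(y) x = y L(x)` recovers `L` from `R`, since an element of `A` is determined by
its left multiples. -/
lemma multiplier_ext_snd {m n : 𝓜(ℂ, A)} (h : ∀ x, m.snd x = n.snd x) : m = n :=
  multiplier_ext (fun x => eq_of_forall_mul_left fun y => by rw [← m.central, ← n.central, h]) h

lemma multiplier_ext_fst {m n : 𝓜(ℂ, A)} (h : ∀ x, m.fst x = n.fst x) : m = n :=
  multiplier_ext h (fun x => eq_of_forall_mul_right fun y => by rw [m.central, n.central, h])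

lemma coe_multiplier_injective : Function.Injective fun a : A => (a : 𝓜(ℂ, A)) := fun _ _ h =>
  eq_of_forall_mul_right fun x => congrArg (fun m : 𝓜(ℂ, A) => m.fst x) h

lemma multiplier_mul_coe (m : 𝓜(ℂ, A)) (a : A) :
    m * (a : 𝓜(ℂ, A)) = ((m.fst a : A) : 𝓜(ℂ, A)) :=
  multiplier_ext_fst fun x => multiplier_fst_mul m a x

lemma coe_mul_multiplier (m : 𝓜(ℂ, A)) (a : A) :
    (a : 𝓜(ℂ, A)) * m = ((m.snd a : A) : 𝓜(ℂ, A)) :=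
  multiplier_ext_snd fun x => multiplier_snd_mul m x a

end Multipliers

namespace CrossedProduct

/-! ### Elements supported at one point, and the norm of the crossed product -/

section Single

variable {A : Type u} [NonUnitalCStarAlgebra A] {G : Type v} [Group G] {α : G →* (A ≃⋆ₐ[ℂ] A)}

variable (α) in
/-- A function as an element of the crossed product. -/
def ofFun (F : G → A) : CrossedProduct α := F

@[simp] lemma ofFun_apply (F : G → A) (g : G) : ofFun α F g = F g := rfl

open scoped Classical in
variable (α) in
/-- The function which takes the value `a` at `t` and vanishes elsewhere. -/
def single (t : G) (a : A) : CrossedProduct α := fun g => if g = t then a else 0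

open scoped Classical in
lemma single_apply (t : G) (a : A) (g : G) : single α t a g = if g = t then a else 0 := rfl

@[simp] lemma single_apply_self (t : G) (a : A) : single α t a t = a := by simp [single_apply]

lemma single_apply_of_ne {t g : G} (h : g ≠ t) (a : A) : single α t a g = 0 := by
  simp [single_apply, h]

lemma single_add (t : G) (a b : A) : single α t (a + b) = single α t a + single α t b := by
  ext g; by_cases h : g = t <;> simp [single_apply, h]

lemma single_smul (t : G) (c : ℂ) (a : A) : single α t (c • a) = c • single α t a := by
  ext g; by_cases h : g = t <;> simp [single_apply, h]

variable [Fintype G]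

lemma mul_single_apply (f : CrossedProduct α) (t : G) (a : A) (g : G) :
    (f * single α t a) g = f (g * t⁻¹) * α (g * t⁻¹) a := by
  rw [mul_apply, Finset.sum_eq_single (g * t⁻¹)]
  · simp
  · intro p _ hp
    rw [single_apply_of_ne, map_zero, mul_zero]
    rintro rfl
    simp at hp
  · simp

lemma single_mul_apply (f : CrossedProduct α) (t : G) (a : A) (g : G) :
    (single α t a * f) g = a * α t (f (t⁻¹ * g)) := by
  rw [mul_apply, Finset.sum_eq_single t]
  · simp
  · intro p _ hp
    rw [single_apply_of_ne hp, zero_mul]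
  · simp

lemma single_mul_single (s t : G) (a b : A) :
    single α s a * single α t b = single α (s * t) (a * α s b) := by
  ext g
  rw [single_mul_apply]
  by_cases h : g = s * t
  · subst h; simp
  · rw [single_apply_of_ne h, single_apply_of_ne, map_zero, mul_zero]
    rintro rfl
    simp at h

lemma star_single (t : G) (a : A) : star (single α t a) = single α t⁻¹ (α t⁻¹ (star a)) := by
  ext g
  rw [star_apply]
  by_cases h : g = t⁻¹
  · subst h; simp
  · rw [single_apply_of_ne h, single_apply_of_ne, star_zero, map_zero]
    rintro rfl
    simp at h

/-- The value at `g` is the matrix entry at `(1, g⁻¹)` of the regular representation. -/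
lemma norm_apply_le (f : CrossedProduct α) (g : G) : ‖f g‖ ≤ ‖f‖ := by
  let _ := CStarAlgebra.spectralOrder A
  have := CStarAlgebra.spectralOrderedRing A
  have h := CStarMatrix.norm_entry_le_norm (M := toMatrix f) (i := 1) (j := g⁻¹)
  simpa [toMatrix_apply, norm_def] using h

variable (α) in
/-- The embedding of the coefficient algebra. -/
def singleOne : A →⋆ₙₐ[ℂ] CrossedProduct α where
  toFun := single α 1
  map_zero' := by ext g; simp [single_apply]
  map_add' := single_add 1
  map_mul' a b := by simp [single_mul_single]
  map_smul' := single_smul 1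
  map_star' a := by simp [star_single]

/-- `(a δ_t)(a δ_t)* = (a a*) δ_1`, so the C*-identity reduces the bound to `t = 1`, where the
embedding of `A` is isometric. -/
lemma norm_single_le (t : G) (a : A) : ‖single α t a‖ ≤ ‖a‖ := by
  have h : single α t a * star (single α t a) = singleOne α (a * star a) := by
    rw [star_single, single_mul_single, ← StarAlgEquiv.mul_apply, ← map_mul]
    simp [singleOne]
  have hi : Function.Injective (singleOne α) := fun a b h => by
    have h' : single α 1 a 1 = single α 1 b 1 := congrFun h 1
    simpa using h'
  have h2 := (NonUnitalStarAlgHom.norm_map (singleOne α) hi (a * star a)).le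
  rw [← h, CStarRing.norm_self_mul_star, CStarRing.norm_self_mul_star] at h2
  exact (mul_self_le_mul_self_iff (norm_nonneg _) (norm_nonneg _)).2 h2

lemma sum_single (f : CrossedProduct α) : ∑ g, single α g (f g) = f := by
  have key : ∀ (s : Finset G) (F : G → CrossedProduct α) (g : G),
      (∑ t ∈ s, F t) g = ∑ t ∈ s, F t g := fun s F g => by
    classical
    induction s using Finset.induction_on with
    | empty => simp
    | insert a s ha ih => rw [Finset.sum_insert ha, Finset.sum_insert ha, add_apply, ih]
  ext g
  rw [key, Finset.sum_eq_single g]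
  · simp
  · intro t _ ht; exact single_apply_of_ne ht.symm _
  · simp

/-- This allows approximation in the crossed product one coefficient at a time. -/
lemma norm_le_sum (f : CrossedProduct α) : ‖f‖ ≤ ∑ g, ‖f g‖ := by
  conv_lhs => rw [← sum_single f]
  exact (norm_sum_le _ _).trans (Finset.sum_le_sum fun g _ => norm_single_le g _)

variable (α) in
/-- The embedding `a ↦ a δ_t` as a bounded linear map. -/
def singleCLM (t : G) : A →L[ℂ] CrossedProduct α :=
  LinearMap.mkContinuous
    { toFun := single α t, map_add' := single_add t, map_smul' := single_smul t } 1
    (fun a => by rw [one_mul]; exact norm_single_le t a)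

@[simp] lemma singleCLM_apply (t : G) (a : A) : singleCLM α t a = single α t a := rfl

variable (α) in
/-- Evaluation at `t` as a bounded linear map. -/
def evalCLM (t : G) : CrossedProduct α →L[ℂ] A :=
  LinearMap.mkContinuous
    { toFun := fun f => f t, map_add' := fun _ _ => rfl, map_smul' := fun _ _ => rfl } 1
    (fun f => by rw [one_mul]; exact norm_apply_le f t)

@[simp] lemma evalCLM_apply (t : G) (f : CrossedProduct α) : evalCLM α t f = f t := rfl

end Single

/-! ### Functoriality of the crossed product -/

section Map

variable {B C : Type*} [NonUnitalCStarAlgebra B] [NonUnitalCStarAlgebra C] {G : Type*} [Group G]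
  [Fintype G] {β : G →* (B ≃⋆ₐ[ℂ] B)} {γ : G →* (C ≃⋆ₐ[ℂ] C)}

/-- The `*`-homomorphism of crossed products induced by an equivariant `*`-homomorphism. -/
def map (φ : B →⋆ₙₐ[ℂ] C) (hφ : ∀ g b, φ (β g b) = γ g (φ b)) :
    CrossedProduct β →⋆ₙₐ[ℂ] CrossedProduct γ where
  toFun f := ofFun γ fun g => φ (f g)
  map_zero' := by ext g; exact map_zero φ
  map_add' f h := by ext g; exact map_add φ _ _
  map_mul' f h := by
    ext g
    change φ ((f * h) g) = _
    rw [mul_apply, map_sum]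
    refine Finset.sum_congr rfl fun p _ => ?_
    rw [map_mul, hφ]; rfl
  map_smul' c f := by ext g; exact map_smul φ c _
  map_star' f := by
    ext g
    change φ (star f g) = _
    rw [star_apply, star_apply, hφ, map_star, ofFun_apply]

@[simp] lemma map_apply (φ : B →⋆ₙₐ[ℂ] C) (hφ : ∀ g b, φ (β g b) = γ g (φ b))
    (f : CrossedProduct β) (g : G) : map φ hφ f g = φ (f g) := rfl

lemma map_injective (φ : B →⋆ₙₐ[ℂ] C) (hφ : ∀ g b, φ (β g b) = γ g (φ b))
    (h : Function.Injective φ) : Function.Injective (map φ hφ) := fun _ _ e =>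
  ext fun g => h (congrFun e g)

lemma map_single (φ : B →⋆ₙₐ[ℂ] C) (hφ : ∀ g b, φ (β g b) = γ g (φ b)) (t : G) (b : B) :
    map φ hφ (single β t b) = single γ t (φ b) := by
  ext g
  by_cases h : g = t <;> simp [single_apply, h]

end Map

/-! ### Part a): multipliers of the crossed product -/

section Multipliers

variable {A G : Type*} [NonUnitalCStarAlgebra A] [Group G] [Fintype G]
  (α : G →* (A ≃⋆ₐ[ℂ] A))

lemma multiplierAction_coe (g : G) (a : A) :
    multiplierAction α g (a : 𝓜(ℂ, A)) = ((α g a : A) : 𝓜(ℂ, A)) :=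
  multiplier_ext
    (fun x => by
      change α g (a * (α g).symm x) = α g a * x
      rw [map_mul, StarAlgEquiv.apply_symm_apply])
    (fun x => by
      change α g ((α g).symm x * a) = x * α g a
      rw [map_mul, StarAlgEquiv.apply_symm_apply])

/-- The canonical inclusion of `A ⋊ G` into `M(A) ⋊ G`. -/
def coeMultiplier : CrossedProduct α →⋆ₙₐ[ℂ] CrossedProduct (multiplierAction α) :=
  map (DoubleCentralizer.coeHom (𝕜 := ℂ) (A := A)) fun g a => (multiplierAction_coe α g a).symm

lemma coeMultiplier_apply (f : CrossedProduct α) (g : G) :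
    coeMultiplier α f g = ((f g : A) : 𝓜(ℂ, A)) := rfl

lemma coeMultiplier_single (t : G) (a : A) :
    coeMultiplier α (single α t a) = single (multiplierAction α) t (a : 𝓜(ℂ, A)) :=
  map_single ..

lemma coeMultiplier_injective : Function.Injective (coeMultiplier α) :=
  map_injective _ _ coe_multiplier_injective

lemma coe_sum {κ : Type*} (s : Finset κ) (F : κ → A) :
    ((∑ p ∈ s, F p : A) : 𝓜(ℂ, A)) = ∑ p ∈ s, ((F p : A) : 𝓜(ℂ, A)) :=
  map_sum (DoubleCentralizer.coeHom (𝕜 := ℂ) (A := A)) F s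

lemma exists_coeMultiplier_mul_left (F : CrossedProduct (multiplierAction α))
    (f : CrossedProduct α) : ∃ f', coeMultiplier α f' = F * coeMultiplier α f := by
  refine ⟨ofFun α fun g => ∑ p, (F p).fst (α p (f (p⁻¹ * g))), ?_⟩
  ext1 g
  rw [mul_apply, coeMultiplier_apply, ofFun_apply, coe_sum]
  refine Finset.sum_congr rfl fun p _ => ?_
  rw [coeMultiplier_apply, multiplierAction_coe, multiplier_mul_coe]

lemma exists_coeMultiplier_mul_right (F : CrossedProduct (multiplierAction α))
    (f : CrossedProduct α) : ∃ f', coeMultiplier α f' = coeMultiplier α f * F := by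
  refine ⟨ofFun α fun g => ∑ p, (multiplierAction α p (F (p⁻¹ * g))).snd (f p), ?_⟩
  ext1 g
  rw [mul_apply, coeMultiplier_apply, ofFun_apply, coe_sum]
  refine Finset.sum_congr rfl fun p _ => ?_
  rw [coeMultiplier_apply, coe_mul_multiplier]

/-- The action of `M(A) ⋊ G` on its ideal `A ⋊ G`. -/
def multiplierHom : CrossedProduct (multiplierAction α) →⋆ₙₐ[ℂ] 𝓜(ℂ, CrossedProduct α) :=
  toMultiplierHom (coeMultiplier α) (coeMultiplier_injective α) (exists_coeMultiplier_mul_left α)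
    (exists_coeMultiplier_mul_right α)

/-- Together with the companion formula for `snd`, this shows how the coefficients of `F` are
recovered from its action on `A δ_1`; it dictates the definition of `multiplierCoeff`. -/
lemma multiplierHom_fst_single (F : CrossedProduct (multiplierAction α)) (a : A) (g : G) :
    (multiplierHom α F).fst (single α 1 a) g = (F g).fst (α g a) := by
  have h := map_toMultiplierHom_fst (coeMultiplier α) (coeMultiplier_injective α)
    (exists_coeMultiplier_mul_left α) (exists_coeMultiplier_mul_right α) F (single α 1 a)
  have h2 := congrFun h g
  rw [coeMultiplier_single, mul_single_apply] at h2
  apply coe_multiplier_injective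
  refine h2.trans ?_
  simp only [inv_one, mul_one]
  rw [← multiplier_mul_coe, ← multiplierAction_coe]

lemma multiplierHom_snd_single (F : CrossedProduct (multiplierAction α)) (a : A) (g : G) :
    (multiplierHom α F).snd (single α 1 a) g = (F g).snd a := by
  have h := map_toMultiplierHom_snd (coeMultiplier α) (coeMultiplier_injective α)
    (exists_coeMultiplier_mul_left α) (exists_coeMultiplier_mul_right α) F (single α 1 a)
  have h2 := congrFun h g
  rw [coeMultiplier_single, single_mul_apply] at h2
  apply coe_multiplier_injective
  refine h2.trans ?_
  simp only [inv_one, one_mul, map_one]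
  exact coe_mul_multiplier _ _

lemma multiplierHom_injective : Function.Injective (multiplierHom α) := fun F F' h => by
  ext1 g
  refine multiplier_ext_snd fun a => ?_
  rw [← multiplierHom_snd_single, ← multiplierHom_snd_single, h]

/-- The coefficient at `g` of a multiplier of `A ⋊ G`. -/
def multiplierCoeff (m : 𝓜(ℂ, CrossedProduct α)) (g : G) : 𝓜(ℂ, A) where
  fst := ((evalCLM α g).comp (m.fst.comp (singleCLM α 1))).comp (equivCLM (α g).symm)
  snd := (evalCLM α g).comp (m.snd.comp (singleCLM α 1))
  central a b := by
    -- At `g`, right multiplication by `c δ_1` multiplies by `α_g(c)`; taking `c = α_g⁻¹(b)`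
    -- produces `b` itself.
    have h := congrFun (m.central (single α 1 a) (single α 1 ((α g).symm b))) g
    rw [mul_single_apply, single_mul_apply] at h
    simpa using h

/-- By construction the two right actions agree on `A δ_1`. Centrality transfers this to the left
actions on all of `A ⋊ G`: the products `a L(f)(g)` agree for every `a`, and these determine
`L(f)(g)`. -/
lemma multiplierHom_surjective : Function.Surjective (multiplierHom α) := fun m => by
  refine ⟨ofFun _ (multiplierCoeff α m), ?_⟩
  have h1 : ∀ a, (multiplierHom α (ofFun _ (multiplierCoeff α m))).snd (single α 1 a) =
      m.snd (single α 1 a) := fun a => by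
    ext1 g
    rw [multiplierHom_snd_single]
    rfl
  have h2 : ∀ f, (multiplierHom α (ofFun _ (multiplierCoeff α m))).fst f = m.fst f := fun f => by
    ext1 g
    refine eq_of_forall_mul_left fun a => ?_
    have e := (multiplierHom α (ofFun _ (multiplierCoeff α m))).central (single α 1 a) f
    rw [h1, m.central] at e
    have e' := congrFun e g
    rw [single_mul_apply, single_mul_apply] at e'
    simpa using e'.symm
  exact multiplier_ext_fst h2

/-- `M(A) ⋊ G` is the multiplier algebra of `A ⋊ G`. -/
def crossedEquiv : 𝓜(ℂ, CrossedProduct α) ≃⋆ₐ[ℂ] CrossedProduct (multiplierAction α) :=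
  (StarAlgEquiv.ofBijective (multiplierHom α)
    ⟨multiplierHom_injective α, multiplierHom_surjective α⟩).symm

lemma multiplierHom_crossedEquiv (m : 𝓜(ℂ, CrossedProduct α)) :
    multiplierHom α (crossedEquiv α m) = m :=
  (StarAlgEquiv.ofBijective (multiplierHom α)
    ⟨multiplierHom_injective α, multiplierHom_surjective α⟩).apply_symm_apply m

lemma crossedEquiv_fst (m : 𝓜(ℂ, CrossedProduct α)) (g : G) (a : A) :
    (crossedEquiv α m g).fst a = m.fst (single α 1 (α g⁻¹ a)) g := by
  conv_rhs => rw [← multiplierHom_crossedEquiv α m, multiplierHom_fst_single,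
    ← StarAlgEquiv.mul_apply, ← map_mul, mul_inv_cancel, map_one]
  rfl

lemma crossedEquiv_snd (m : 𝓜(ℂ, CrossedProduct α)) (g : G) (a : A) :
    (crossedEquiv α m g).snd a = m.snd (single α 1 a) g := by
  conv_rhs => rw [← multiplierHom_crossedEquiv α m, multiplierHom_snd_single]

lemma crossedEquiv_coe (x : CrossedProduct α) :
    crossedEquiv α (x : 𝓜(ℂ, CrossedProduct α)) = coeMultiplier α x := by
  apply multiplierHom_injective α
  rw [multiplierHom_crossedEquiv]
  exact (toMultiplierHom_coe ..).symm

end Multipliers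

end CrossedProduct

/-! ### Consequences of primeness -/

section Prime

variable {A : Type*} [NonUnitalCStarAlgebra A]

/-- The elements `z` with `x A z = 0` form a two-sided ideal containing `h ≠ 0`, hence an essential
one. It is annihilated by `x y` for every `y`, so `x A = 0` and `x = 0`. -/
lemma IsPrimeAlgebra.eq_zero_of_forall_mul (hA : IsPrimeAlgebra A) {x h : A} (hh : h ≠ 0)
    (H : ∀ y, x * y * h = 0) : x = 0 := by
  let I : Submodule ℂ A :=
    { carrier := {z | ∀ y, x * y * z = 0}
      add_mem' := fun {a b} ha hb y => by rw [mul_add, ha, hb, add_zero]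
      zero_mem' := fun y => mul_zero _
      smul_mem' := fun c z hz y => by rw [mul_smul_comm, hz, smul_zero] }
  have hI : IsTwoSidedIdeal I := fun a z hz =>
    ⟨fun y => by rw [← mul_assoc, mul_assoc x]; exact hz _,
      fun y => by rw [← mul_assoc, hz y, zero_mul]⟩
  have hI0 : I ≠ ⊥ := fun e => hh (by
    have : h ∈ I := H
    rwa [e, Submodule.mem_bot] at this)
  have hess := hA I hI hI0
  refine eq_of_forall_mul_right fun y => ?_
  rw [zero_mul]
  exact hess _ fun z hz => hz y

/-- Soft thresholding of a nonzero self-adjoint element `P`: there is a nonzero self-adjoint `h` on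
which the element `P w` of the ideal generated by `P` acts as a unit. -/
lemma exists_local_unit {P : A} (hP : IsSelfAdjoint P) (hP0 : P ≠ 0) :
    ∃ h w : A, h ≠ 0 ∧ IsSelfAdjoint h ∧ P * w * h = h ∧ h * (P * w) = h := by
  set r := ‖P‖ with hr
  have hr0 : 0 < r := norm_pos_iff.2 hP0
  let clip : ℝ → ℝ := fun t => max (-(r / 2)) (min t (r / 2))
  have hclip : Continuous clip := by fun_prop
  have hclip0 : clip 0 = 0 := by
    simp only [clip]
    rw [min_eq_left (by positivity), max_eq_right (by linarith)]
  let f : ℝ → ℝ := fun t => t - clip t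
  have hf : Continuous f := by fun_prop
  have hf0 : f 0 = 0 := by simp [f, hclip0]
  -- A continuous function vanishing at `0` and equal to `1 / t` for `|t| ≥ r / 4`, in particular
  -- wherever `f` does not vanish. Both conditions are needed for the nonunital functional calculus.
  let w : ℝ → ℝ := fun t => t / max (t ^ 2) ((r / 4) ^ 2)
  have hw : Continuous w := continuous_id.div (by fun_prop) fun t =>
    (lt_max_of_lt_right (by positivity)).ne'
  have hw0 : w 0 = 0 := by simp [w]
  have hfix : ∀ t, t * w t * f t = f t := fun t => by
    by_cases ht : |t| ≤ r / 2
    · have h1 := abs_le.1 ht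
      have : f t = 0 := by
        simp only [f, clip]
        rw [min_eq_left h1.2, max_eq_right h1.1, sub_self]
      rw [this, mul_zero]
    · have h2 : (r / 4) ^ 2 ≤ t ^ 2 := by
        rw [← sq_abs t]
        gcongr
        linarith
      have h3 : t ≠ 0 := by rintro rfl; simp at ht; linarith
      have : t * w t = 1 := by
        simp only [w]
        rw [max_eq_left h2]
        field_simp
      rw [this, one_mul]
  have e1 : P = cfcₙ (id : ℝ → ℝ) P := (cfcₙ_id ℝ P).symm
  have e2 : P * cfcₙ w P * cfcₙ f P = cfcₙ f P := by
    nth_rewrite 1 [e1]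
    rw [← cfcₙ_mul id w P (by fun_prop) rfl hw.continuousOn hw0,
      ← cfcₙ_mul (fun x => id x * w x) f P (continuous_id.mul hw).continuousOn (by simp)
        hf.continuousOn hf0]
    exact congrArg (fun F : ℝ → ℝ => cfcₙ F P) (funext hfix)
  have hcomm : Commute (P * cfcₙ w P) (cfcₙ f P) := by
    refine Commute.mul_left ?_ (cfcₙ_commute_cfcₙ w f P)
    nth_rewrite 1 [e1]
    exact cfcₙ_commute_cfcₙ id f P
  refine ⟨cfcₙ f P, cfcₙ w P, fun h0 => ?_, cfcₙ_predicate f P, e2, ?_⟩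
  -- If `f(P) = 0`, then `P` equals its truncation, whose norm is at most `‖P‖ / 2`.
  · have e3 : cfcₙ clip P = P := by
      have := cfcₙ_sub id clip P (by fun_prop) rfl hclip.continuousOn hclip0
      change cfcₙ f P = _ at this
      rw [h0, ← e1] at this
      exact (sub_eq_zero.1 this.symm).symm
    have h4 : ‖cfcₙ clip P‖ ≤ r / 2 := norm_cfcₙ_le fun t _ => by
      rw [Real.norm_eq_abs, abs_le]
      exact ⟨le_max_left _ _, max_le (by linarith) (min_le_right _ _)⟩
    rw [e3] at h4
    linarith
  · rw [← hcomm.eq, e2]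

/-- In a prime C*-algebra, an element `Q` commuting with the hereditary subalgebra generated by `h`
acts as a scalar there. -/
lemma IsPrimeAlgebra.exists_scalar (hA : IsPrimeAlgebra A) {Q h : A} (hQ : IsSelfAdjoint Q)
    (hh : IsSelfAdjoint h) (H : ∀ y, Q * (h * y * h) = h * y * h * Q) :
    ∃ r : ℝ, h * Q * h = r • (h * h) := by
  by_cases h0 : h = 0
  · exact ⟨0, by simp [h0]⟩
  let _ := CStarAlgebra.spectralOrder A
  have := CStarAlgebra.spectralOrderedRing A
  let _ := CStarAlgebra.spectralOrder 𝓜(ℂ, A)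
  have := CStarAlgebra.spectralOrderedRing 𝓜(ℂ, A)
  -- `M(A)` supplies the unit required to form `Q - r`.
  let j : A →⋆ₙₐ[ℂ] 𝓜(ℂ, A) := DoubleCentralizer.coeHom
  have hj : Function.Injective j := coe_multiplier_injective
  have hl : ∀ m a, m * j a = j (m.fst a) := multiplier_mul_coe
  have hr : ∀ m a, j a * m = j (m.snd a) := coe_mul_multiplier
  have hjh : star (j h) = j h := by rw [← map_star, hh.star_eq]
  have key : ∀ r : ℝ, j h * (j Q - algebraMap ℝ _ r) * j h = j (h * Q * h) - r • j (h * h) :=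
    fun r => by
      rw [mul_sub, sub_mul, Algebra.algebraMap_eq_smul_one, mul_smul_comm, mul_one, smul_mul_assoc,
        map_mul, map_mul, map_mul]
  -- Let `a = Q - r`. Its negative part commutes with `h A h`, so `(a⁻ h) y (h a⁺) = (h y h) a⁻ a⁺ =
  -- 0` for all `y`. Primeness gives `h a⁺ = 0` or `a⁻ h = 0`, and this fixes the sign of `h a h`.
  have dich : ∀ r : ℝ, 0 ≤ j (h * Q * h) - r • j (h * h) ∨
      j (h * Q * h) - r • j (h * h) ≤ 0 := fun r => by
    set a : 𝓜(ℂ, A) := j Q - algebraMap ℝ _ r with ha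
    have hsa : IsSelfAdjoint a := (hQ.map j).sub (.algebraMap _ (.all r))
    have hcomm : ∀ y, Commute a⁻ (j (h * y * h)) := fun y => by
      have h1 : Commute (algebraMap ℝ 𝓜(ℂ, A) r) (j (h * y * h)) := Algebra.commutes r _
      refine Commute.cfcₙ_real (Commute.sub_left ?_ h1) _
      change j Q * j _ = j _ * j Q
      rw [← map_mul, ← map_mul, H]
    have hz : ∀ y, a⁻.fst h * y * a⁺.snd h = 0 := fun y => hj (by
      have : j (a⁻.fst h * y * a⁺.snd h) = a⁻ * j (h * y * h) * a⁺ := by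
        rw [map_mul, map_mul, ← hl, ← hr, map_mul, map_mul]
        simp only [mul_assoc]
      rw [this, (hcomm y).eq, mul_assoc, CFC.negPart_mul_posPart, mul_zero, map_zero])
    have hsplit : j h * a * j h = j h * a⁺ * j h - j h * a⁻ * j h := by
      rw [← sub_mul, ← mul_sub, CFC.posPart_sub_negPart a hsa]
    have hp : 0 ≤ j h * a⁺ * j h := by
      have := star_right_conjugate_nonneg (CFC.posPart_nonneg a) (j h)
      rwa [hjh] at this
    have hn : 0 ≤ j h * a⁻ * j h := by
      have := star_right_conjugate_nonneg (CFC.negPart_nonneg a) (j h)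
      rwa [hjh] at this
    rw [← key, ← ha, hsplit]
    by_cases hp0 : a⁺.snd h = 0
    · right
      rw [hr, hp0, map_zero, zero_mul, zero_sub]
      exact neg_nonpos.2 hn
    · left
      rw [mul_assoc (j h) a⁻, hl a⁻, hA.eq_zero_of_forall_mul hp0 hz, map_zero, mul_zero, sub_zero]
      exact hp
  have hcont : Continuous fun r : ℝ => j (h * Q * h) - r • j (h * h) := by fun_prop
  have hle := CStarAlgebra.star_right_conjugate_le_norm_smul (a := h) (b := Q)
  have hle' := CStarAlgebra.star_right_conjugate_le_norm_smul (a := h) (b := -Q) hQ.neg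
  rw [hh.star_eq] at hle hle'
  have jle : ∀ x y : A, x ≤ y → j x ≤ j y := fun x y hxy => by
    rw [← sub_nonneg] at hxy ⊢
    rw [← map_sub]
    exact map_nonneg j hxy
  have jsmul : ∀ (r : ℝ) x, j (r • x) = r • j x := fun r x => by
    rw [← Complex.coe_smul, map_smul, Complex.coe_smul]
  -- The two closed sets of `r` cover the line and are nonempty because `-‖Q‖ h² ≤ h Q h ≤ ‖Q‖ h²`.
  -- By connectedness they meet, and there both inequalities hold.
  obtain ⟨r, -, hr1, hr2⟩ := isPreconnected_closed_iff.1 (isPreconnected_univ (α := ℝ))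
    {r | 0 ≤ j (h * Q * h) - r • j (h * h)} {r | j (h * Q * h) - r • j (h * h) ≤ 0}
    (isClosed_le continuous_const hcont) (isClosed_le hcont continuous_const)
    (fun r _ => dich r)
    ⟨-‖Q‖, trivial, by
      have := jle _ _ hle'
      rw [jsmul, norm_neg, mul_neg, neg_mul, map_neg] at this
      change 0 ≤ j (h * Q * h) - (-‖Q‖) • j (h * h)
      rw [neg_smul, sub_neg_eq_add]
      exact neg_le_iff_add_nonneg'.1 this⟩
    ⟨‖Q‖, trivial, by
      have := jle _ _ hle
      rw [jsmul] at this
      exact sub_nonpos.2 this⟩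
  refine ⟨r, hj ?_⟩
  rw [jsmul]
  exact sub_eq_zero.1 (le_antisymm hr2 hr1)

end Prime

/-! ### Twisted module maps between ideals are multiples of isometries -/

section Graph

variable {A : Type*} [NonUnitalCStarAlgebra A]

/-- The graph `Γ` of a left `A`-linear bijection `φ` between ideals of `A` which satisfies
`φ (c x) = φ c σ(x)`. -/
structure IsTwistedGraph (σ : A ≃⋆ₐ[ℂ] A) (Γ : Submodule ℂ (A × A)) : Prop where
  left : ∀ (x : A) {p : A × A}, p ∈ Γ → (x * p.1, x * p.2) ∈ Γ
  right : ∀ (x : A) {p : A × A}, p ∈ Γ → (p.1 * x, p.2 * σ x) ∈ Γ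
  snd_eq_zero : ∀ {p : A × A}, p ∈ Γ → p.1 = 0 → p.2 = 0
  fst_eq_zero : ∀ {p : A × A}, p ∈ Γ → p.2 = 0 → p.1 = 0

variable {σ : A ≃⋆ₐ[ℂ] A} {Γ : Submodule ℂ (A × A)}

lemma IsTwistedGraph.unique (hΓ : IsTwistedGraph σ Γ) {c d d' : A} (h : (c, d) ∈ Γ)
    (h' : (c, d') ∈ Γ) : d = d' :=
  sub_eq_zero.1 (hΓ.snd_eq_zero (Γ.sub_mem h h') (sub_self c))

/-- In a prime C*-algebra, such a bijection `φ` satisfies `φ(c) φ(d)* = r c d*` for a scalar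
`r > 0`; in particular it is a multiple of an isometry. -/
lemma IsTwistedGraph.exists_scalar (hΓ : IsTwistedGraph σ Γ) (hA : IsPrimeAlgebra A)
    (h0 : Γ ≠ ⊥) : ∃ r : ℝ, 0 < r ∧ ∀ p ∈ Γ, ∀ q ∈ Γ, p.2 * star q.2 = r • (p.1 * star q.1) := by
  obtain ⟨p, hp, hp0⟩ := Submodule.exists_mem_ne_zero_of_ne_bot h0
  have hp1 : p.1 ≠ 0 := fun e => hp0 (Prod.ext e (hΓ.snd_eq_zero hp e))
  -- Write `φ` for the map with graph `Γ`. The local unit `k` for `h` is built inside the domain of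
  -- `φ`, and `w = φ(k)`.
  obtain ⟨h, w₀, hh0, hsa, hkh, hhk⟩ := exists_local_unit (IsSelfAdjoint.star_mul_self p.1)
    (by rwa [Ne, CStarRing.star_mul_self_eq_zero_iff])
  set k := star p.1 * p.1 * w₀ with hk
  set w := star p.1 * p.2 * σ w₀ with hw
  have hkw : (k, w) ∈ Γ := hΓ.right w₀ (hΓ.left (star p.1) hp)
  clear_value k w
  have hmem : ∀ a, a * k = a → (a, a * w) ∈ Γ := fun a ha => by
    have := hΓ.left a hkw
    rwa [ha] at this
  -- Both sides are `φ(a)`, computed from `a = a k` and from `a = k a`.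
  have hcomm : ∀ a, a * k = a → k * a = a → a * w = w * σ a := fun a ha ha' => by
    have := hΓ.right a hkw
    simp only [ha'] at this
    exact hΓ.unique (hmem a ha) this
  have hcomm' : ∀ a, star a * k = star a → k * star a = star a → star w * a = σ a * star w :=
    fun a ha ha' => by
      have := congrArg star (hcomm (star a) ha ha')
      rw [star_mul, star_mul, star_star, ← map_star, star_star] at this
      exact this
  have hwh : star w * h = σ h * star w := hcomm' h (by rwa [hsa.star_eq]) (by rwa [hsa.star_eq])
  -- For `b = h y h`, `w w* b = w σ(b) w* = b w w*`, so `w w*` acts as a scalar between two factors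
  -- `h`.
  obtain ⟨r, hr⟩ := hA.exists_scalar (Q := w * star w) (.mul_star_self w) hsa fun y => by
    have e1 : ∀ y, h * y * h * k = h * y * h := fun y => by rw [mul_assoc _ h, hhk]
    have e2 : ∀ y, k * (h * y * h) = h * y * h := fun y => by rw [← mul_assoc, ← mul_assoc, hkh]
    have e3 : star (h * y * h) = h * star y * h := by
      rw [star_mul, star_mul, hsa.star_eq, mul_assoc]
    rw [mul_assoc, hcomm' _ (by rw [e3, e1]) (by rw [e3, e2]), ← mul_assoc,
      ← hcomm _ (e1 y) (e2 y), mul_assoc]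
  have hsq : h * h ≠ 0 := fun e => hh0 (by
    rw [← CStarRing.star_mul_self_eq_zero_iff, hsa.star_eq, e])
  refine ⟨r, ?_, fun p hp q hq => ?_⟩
  -- For `r ≤ 0` the positive element `(h w)(h w)* = r h²` is also nonpositive, so `φ(h) = h w = 0`,
  -- contrary to injectivity.
  · by_contra hneg
    let _ := CStarAlgebra.spectralOrder A
    have := CStarAlgebra.spectralOrderedRing A
    have h1 : h * (w * star w) * h = h * w * star (h * w) := by
      rw [star_mul, hsa.star_eq]; simp only [mul_assoc]
    have h2 : h * w * star (h * w) ≤ 0 := by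
      rw [← h1, hr, ← neg_nonneg, ← neg_smul]
      refine smul_nonneg (by linarith) ?_
      nth_rewrite 1 [← hsa.star_eq]
      exact star_mul_self_nonneg h
    have h3 := le_antisymm h2 (mul_star_self_nonneg (h * w))
    rw [CStarRing.mul_star_self_eq_zero_iff] at h3
    exact hh0 (hΓ.fst_eq_zero (hmem h hhk) h3)
  · rw [← sub_eq_zero]
    -- By primeness it suffices to test against `y h²`. The factors `h` bring both `p.2` and `q.2`
    -- back to `w`, and the scalar identity for `h w w* h` applies.
    refine hA.eq_zero_of_forall_mul hsq fun y => ?_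
    have e1 : star q.2 * y * h = σ (star q.1 * y) * (star w * h) := by
      -- Two evaluations of `φ(h y* q.1)`, by right and by left linearity.
      have e : h * w * σ (star y * q.1) = h * (star y * q.2) := by
        refine hΓ.unique (c := h * (star y * q.1)) (hΓ.right _ (hmem h hhk)) ?_
        exact hΓ.left h (hΓ.left (star y) hq)
      have e' := congrArg star e
      simp only [star_mul, star_star, hsa.star_eq, ← map_star] at e'
      rw [← e']
    have e2 : p.2 * σ (star q.1 * y) * σ h = p.1 * (star q.1 * y) * h * w := by
      refine hΓ.unique (c := p.1 * (star q.1 * y) * h) (hΓ.right h (hΓ.right _ hp)) ?_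
      refine hmem _ ?_
      rw [mul_assoc _ h, hhk]
    have e3 : p.2 * star q.2 * y * (h * h) = p.1 * (star q.1 * y) * (h * (w * star w) * h) :=
      calc _ = p.2 * (star q.2 * y * h) * h := by simp only [mul_assoc]
        _ = p.2 * σ (star q.1 * y) * σ h * star w * h := by
          rw [e1, hwh]; simp only [mul_assoc]
        _ = _ := by rw [e2]; simp only [mul_assoc]
    rw [sub_mul, sub_mul, e3, hr]
    simp only [mul_smul_comm, smul_mul_assoc, mul_assoc, sub_self]

end Graph

/-! ### From a twisted isometry to a unitary local multiplier -/

section ImplementingUnitary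

variable {A : Type*} [NonUnitalCStarAlgebra A]

lemma EssentialIdeal.le_top' (L : EssentialIdeal A) : L ≤ ⊤ := fun _ _ => trivial

/-- The action of `A` on an essential ideal. -/
def idealMultiplier (L : EssentialIdeal A) (a : A) : 𝓜(ℂ, L) :=
  restrict L.le_top' (((⟨a, EssentialIdeal.mem_top a⟩ : (⊤ : EssentialIdeal A)) :
    𝓜(ℂ, (⊤ : EssentialIdeal A))))

/-- Passing to a smaller essential ideal does not change the class in the limit, so identities
involving `A` can be checked inside `M(L)`. -/
lemma LocalMultipliers.of_eq (L : EssentialIdeal A) (a : A) :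
    LocalMultipliers.of a = LocalMultipliers.ofMultiplier L (idealMultiplier L a) :=
  congrArg LocalMultipliers.ofPre (PreLocalMultipliers.mk_restrict L.le_top' _).symm

/-- `R(x) R(y)* = x L(R(y)*)` by centrality, so preservation of `x y*` means `L(R(y)*) = y*` for all
`y`, which is `m m* = 1`. -/
lemma multiplier_mul_star_eq_one {m : 𝓜(ℂ, A)}
    (h : ∀ x y, m.snd x * star (m.snd y) = x * star y) : m * star m = 1 :=
  multiplier_ext_snd fun y => by
    change star (m.fst (star (m.snd y))) = y
    rw [star_eq_iff_star_eq, eq_comm]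
    exact eq_of_forall_mul_left fun x => by rw [← m.central, h]

lemma multiplier_star_mul_eq_one {m : 𝓜(ℂ, A)}
    (h : ∀ x y, star (m.fst x) * m.fst y = star x * y) : star m * m = 1 :=
  multiplier_ext_fst fun y => by
    change star (m.snd (star (m.fst y))) = y
    rw [star_eq_iff_star_eq, eq_comm]
    exact eq_of_forall_mul_right fun x => by rw [m.central, h]

/-- A subspace of `A × A` which is the graph of an isometry defined on an ideal `L` and leaving `L`
invariant. -/
lemma exists_clm_of_graph (L : EssentialIdeal A) (Γ : Submodule ℂ (A × A))
    (hiso : ∀ p ∈ Γ, ‖p.2‖ = ‖p.1‖) (hex : ∀ c ∈ L, ∃ d ∈ L, (c, d) ∈ Γ) :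
    ∃ T : L →L[ℂ] L, ∀ c : L, ((c : A), (T c : A)) ∈ Γ := by
  choose F hFL hF using fun c : L => hex c c.2
  have huniq : ∀ {c d d' : A}, (c, d) ∈ Γ → (c, d') ∈ Γ → d = d' := fun h h' => by
    have := hiso _ (Γ.sub_mem h h')
    rw [Prod.snd_sub, Prod.fst_sub, sub_self, norm_zero, norm_eq_zero] at this
    exact sub_eq_zero.1 this
  refine ⟨LinearMap.mkContinuous
    { toFun := fun c => ⟨F c, hFL c⟩
      map_add' := fun x y => Subtype.ext (huniq (hF (x + y)) (Γ.add_mem (hF x) (hF y)))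
      map_smul' := fun c x => Subtype.ext (huniq (hF (c • x)) (Γ.smul_mem c (hF x))) } 1
    (fun x => by rw [one_mul]; exact (hiso _ (hF x)).le), hF⟩

/-- A unitary of `M_loc(A)` implementing an automorphism `σ`, from the graph of the right
multiplication by its adjoint. -/
lemma exists_unitary_of_graph (hA : IsPrimeAlgebra A) {σ : A ≃⋆ₐ[ℂ] A} {Γ : Submodule ℂ (A × A)}
    (hl : ∀ (x : A) {p : A × A}, p ∈ Γ → (x * p.1, x * p.2) ∈ Γ)
    (hr : ∀ (x : A) {p : A × A}, p ∈ Γ → (p.1 * x, p.2 * σ x) ∈ Γ)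
    (hu : ∀ p ∈ Γ, ∀ q ∈ Γ, p.2 * star q.2 = p.1 * star q.1)
    (hc : IsClosed (Γ : Set (A × A))) (h0 : Γ ≠ ⊥) :
    ∃ u ∈ unitary (LocalMultipliers A),
      ∀ a : A, LocalMultipliers.of (σ a) = u * LocalMultipliers.of a * star u := by
  have hiso : ∀ p ∈ Γ, ‖p.2‖ = ‖p.1‖ := fun p hp => by
    have h := congrArg norm (hu p hp p hp)
    rw [CStarRing.norm_self_mul_star, CStarRing.norm_self_mul_star] at h
    exact (mul_self_inj (norm_nonneg _) (norm_nonneg _)).1 h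
  have huniq : ∀ {c d d' : A}, (c, d) ∈ Γ → (c, d') ∈ Γ → d = d' := fun h h' => by
    have := hiso _ (Γ.sub_mem h h')
    rw [Prod.snd_sub, Prod.fst_sub, sub_self, norm_zero, norm_eq_zero] at this
    exact sub_eq_zero.1 this
  obtain ⟨p₀, hp₀, hp₀0⟩ := Submodule.exists_mem_ne_zero_of_ne_bot h0
  have hp₁ : p₀.1 ≠ 0 := fun e => hp₀0 (Prod.ext e (by
    rw [Prod.snd_zero, ← norm_eq_zero, hiso _ hp₀, e, norm_zero]))
  have hp₂ : p₀.2 ≠ 0 := fun e => hp₁ (by rw [← norm_eq_zero, ← hiso _ hp₀, e, norm_zero])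
  -- The inner product on the other side is obtained from primeness after left multiplication by
  -- `p₀.2 y`: both sides become the value of `φ` at `p₀.1 σ⁻¹(y) p.1* q.1`, where `φ` has graph
  -- `Γ`.
  have hu' : ∀ p ∈ Γ, ∀ q ∈ Γ, star p.2 * q.2 = σ (star p.1 * q.1) := fun p hp q hq => by
    by_contra hne
    refine hp₂ (hA.eq_zero_of_forall_mul (sub_ne_zero.2 hne) fun y => ?_)
    have he := hr (σ.symm y) hp₀
    rw [StarAlgEquiv.apply_symm_apply] at he
    have e1 := hr (star p.1 * q.1) he
    have e2 := hl (p₀.1 * σ.symm y * star p.1) hq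
    rw [← hu _ he _ hp] at e2
    rw [mul_sub, sub_eq_zero, ← mul_assoc]
    refine huniq (c := p₀.1 * σ.symm y * (star p.1 * q.1)) ?_ e1
    have e3 : p₀.1 * σ.symm y * (star p.1 * q.1) = p₀.2 * y * star p.2 * q.1 := by
      rw [← mul_assoc, hu _ he _ hp]
    rw [e3]
    exact e2
  have hdom : IsTwoSidedIdeal (Γ.map (LinearMap.fst ℂ A A)) := by
    rintro a _ ⟨p, hp, rfl⟩
    exact ⟨⟨_, hl a hp, rfl⟩, ⟨_, hr a hp, rfl⟩⟩
  have : CompleteSpace Γ := hc.completeSpace_coe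
  -- The first projection is isometric on the complete space `Γ`.
  have hdomc : IsClosed (Γ.map (LinearMap.fst ℂ A A) : Set A) := by
    have hi : Isometry fun p : Γ => (p : A × A).1 :=
      AddMonoidHomClass.isometry_of_norm
        ((LinearMap.fst ℂ A A).toAddMonoidHom.comp Γ.subtype.toAddMonoidHom) fun p => by
          change ‖(p : A × A).1‖ = max ‖(p : A × A).1‖ ‖(p : A × A).2‖
          rw [hiso _ p.2, max_self]
    have := hi.isClosedEmbedding.isClosed_range
    convert this using 1
    ext x
    simp
  let K : EssentialIdeal A := ⟨_, hdom, hdomc, hA _ hdom fun e => hp₁ (by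
    have : p₀.1 ∈ Γ.map (LinearMap.fst ℂ A A) := ⟨_, hp₀, rfl⟩
    rwa [e, Submodule.mem_bot] at this)⟩
  have hK : ∀ {x}, x ∈ K → ∃ d, (x, d) ∈ Γ := by
    rintro _ ⟨p, hp, rfl⟩
    exact ⟨p.2, hp⟩
  -- For the desired `u`, `c u* = φ(c)` requires `c ∈ K`, while `u* c = φ(σ⁻¹(c))` requires `c ∈
  -- σ(K)`. The graph of the second map is `Γ'`.
  let L : EssentialIdeal A := min K (K.map σ)
  let Γ' : Submodule ℂ (A × A) :=
    Γ.comap ((equivCLM σ.symm).toLinearMap.prodMap LinearMap.id)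
  have hΓ' : ∀ {c d}, (c, d) ∈ Γ' ↔ (σ.symm c, d) ∈ Γ := Iff.rfl
  have hiso' : ∀ p ∈ Γ', ‖p.2‖ = ‖p.1‖ := fun p hp =>
    (hiso _ hp).trans (StarAlgEquiv.norm_map σ.symm p.1)
  obtain ⟨R, hR⟩ := exists_clm_of_graph L Γ hiso fun c hcL => by
    obtain ⟨d, hd⟩ := hK hcL.1
    refine ⟨d, ?_, hd⟩
    -- `c` is a limit of products `w c` with `w ∈ L`, and `φ(w c) = w φ(c) ∈ L`; the isometry `φ`
    -- carries the limit over.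
    rw [← SetLike.mem_coe, ← L.isClosed_coe.closure_eq, Metric.mem_closure_iff]
    intro ε hε
    obtain ⟨_, ⟨w, rfl⟩, hw⟩ := Metric.mem_closure_iff.1 (mem_closure_mul' L ⟨c, hcL⟩) ε hε
    refine ⟨w * d, L.mul_mem_right _ w.2, ?_⟩
    rw [dist_eq_norm] at hw ⊢
    exact (hiso _ (Γ.sub_mem hd (hl w hd))).trans_lt hw
  obtain ⟨F, hF⟩ := exists_clm_of_graph L Γ' hiso' fun c hcL => by
    obtain ⟨d, hd⟩ := hK hcL.2
    refine ⟨d, ?_, hd⟩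
    rw [← SetLike.mem_coe, ← L.isClosed_coe.closure_eq, Metric.mem_closure_iff]
    intro ε hε
    obtain ⟨_, ⟨w, rfl⟩, hw⟩ := Metric.mem_closure_iff.1 (mem_closure_mul L ⟨c, hcL⟩) ε hε
    refine ⟨d * w, L.mul_mem_left _ w.2, ?_⟩
    rw [dist_eq_norm] at hw ⊢
    have hd' : (c * (w : A), d * (w : A)) ∈ Γ' := by
      have := hr (σ.symm w) hd
      rw [StarAlgEquiv.apply_symm_apply] at this
      rw [hΓ', map_mul]
      exact this
    exact (hiso' _ (Γ'.sub_mem (x := (c, d)) hd hd')).trans_lt hw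
  -- This multiplier is `u*`. Centrality holds because both sides are values of `φ` at `x σ⁻¹(y)`.
  let m : 𝓜(ℂ, L) :=
    { fst := F
      snd := R
      central := fun x y => Subtype.ext (by
        have h1 := hr (σ.symm y) (hR x)
        rw [StarAlgEquiv.apply_symm_apply] at h1
        exact huniq h1 (hl x (hF y))) }
  have hm : ∀ x, m.snd x = R x := fun _ => rfl
  have hm' : ∀ x, m.fst x = F x := fun _ => rfl
  have hm1 : m * star m = 1 := multiplier_mul_star_eq_one fun x y =>
    Subtype.ext (hu _ (hR x) _ (hR y))
  have hm2 : star m * m = 1 := multiplier_star_mul_eq_one fun x y => Subtype.ext (by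
    have h := hu' _ (hF x) _ (hF y)
    have h2 : σ (star (σ.symm (x : A)) * σ.symm (y : A)) = star (x : A) * y := by
      rw [← map_star, ← map_mul, StarAlgEquiv.apply_symm_apply]
    exact h.trans h2)
  have hcomm : ∀ a, m * idealMultiplier L (σ a) = idealMultiplier L a * m := fun a =>
    multiplier_ext_snd fun x => Subtype.ext
      (huniq (hr a (hR x)) (hR ((idealMultiplier L a).snd x)))
  refine ⟨LocalMultipliers.ofMultiplier L (star m), ?_, fun a => ?_⟩
  · refine Unitary.mem_iff.2 ⟨?_, ?_⟩
    · rw [← map_star, ← map_mul, star_star, hm1, map_one]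
    · rw [← map_star, ← map_mul, star_star, hm2, map_one]
  · rw [LocalMultipliers.of_eq L, LocalMultipliers.of_eq L, ← map_star, ← map_mul, ← map_mul,
      star_star, mul_assoc, ← hcomm, ← mul_assoc, hm2, one_mul]

/-- A twisted graph over a prime C*-algebra comes from a unitary local multiplier. -/
lemma IsTwistedGraph.exists_unitary (hA : IsPrimeAlgebra A) {σ : A ≃⋆ₐ[ℂ] A}
    {Γ : Submodule ℂ (A × A)} (hΓ : IsTwistedGraph σ Γ) (h0 : Γ ≠ ⊥) :
    ∃ u ∈ unitary (LocalMultipliers A),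
      ∀ a : A, LocalMultipliers.of (σ a) = u * LocalMultipliers.of a * star u := by
  obtain ⟨r, hr0, hr⟩ := hΓ.exists_scalar hA h0
  set s : ℂ := ((√r : ℝ) : ℂ) with hs
  have hs0 : s ≠ 0 := by
    rw [hs]
    exact_mod_cast (Real.sqrt_pos.2 hr0).ne'
  have hss : ∀ x : A, s⁻¹ • s⁻¹ • (r • x) = x := fun x => by
    have : s⁻¹ * (s⁻¹ * (r : ℂ)) = 1 := by
      have h2 : (r : ℂ) = s * s := by rw [hs]; exact_mod_cast (Real.mul_self_sqrt hr0.le).symm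
      rw [h2]
      field_simp
    rw [← Complex.coe_smul, smul_smul, smul_smul, mul_assoc, this, one_smul]
  -- The graph of `φ / √r`, which preserves the products `c d*`; its closure inherits the algebraic
  -- identities by continuity.
  let Γ₁ : Submodule ℂ (A × A) := Γ.comap (LinearMap.id.prodMap (s • LinearMap.id))
  have hΓ₁ : ∀ {p : A × A}, p ∈ Γ₁ ↔ (p.1, s • p.2) ∈ Γ := Iff.rfl
  have hl₁ : ∀ (x : A) {p : A × A}, p ∈ Γ₁ → (x * p.1, x * p.2) ∈ Γ₁ := fun x p hp => by
    have := hΓ.left x (hΓ₁.1 hp)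
    rw [mul_smul_comm] at this
    exact this
  have hr₁ : ∀ (x : A) {p : A × A}, p ∈ Γ₁ → (p.1 * x, p.2 * σ x) ∈ Γ₁ := fun x p hp => by
    have := hΓ.right x (hΓ₁.1 hp)
    rw [smul_mul_assoc] at this
    exact this
  have hu₁ : ∀ p ∈ Γ₁, ∀ q ∈ Γ₁, p.2 * star q.2 = p.1 * star q.1 := fun p hp q hq => by
    have h := hr _ (hΓ₁.1 hp) _ (hΓ₁.1 hq)
    have hsr : star s = s := Complex.conj_ofReal _
    have e : r • (p.1 * star q.1) = s • s • (p.2 * star q.2) := by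
      rw [← h, star_smul, hsr, smul_mul_assoc, mul_smul_comm]
    rw [← hss (p.1 * star q.1), e, inv_smul_smul₀ hs0, inv_smul_smul₀ hs0]
  have hmem := fun p (hp : p ∈ Γ₁.topologicalClosure) =>
    (show p ∈ closure (Γ₁ : Set (A × A)) from hp)
  refine exists_unitary_of_graph hA (Γ := Γ₁.topologicalClosure) (fun x p hp => ?_)
    (fun x p hp => ?_) (fun p hp q hq => ?_) Γ₁.isClosed_topologicalClosure fun e => ?_
  · exact map_mem_closure (f := fun p : A × A => (x * p.1, x * p.2)) (by fun_prop) (hmem p hp)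
      fun p hp => hl₁ x hp
  · exact map_mem_closure (f := fun p : A × A => (p.1 * x, p.2 * σ x)) (by fun_prop) (hmem p hp)
      fun p hp => hr₁ x hp
  · have hcl : IsClosed {z : (A × A) × (A × A) | z.1.2 * star z.2.2 = z.1.1 * star z.2.1} :=
      isClosed_eq (by fun_prop) (by fun_prop)
    have hsub : (Γ₁ : Set (A × A)) ×ˢ (Γ₁ : Set (A × A)) ⊆
        {z : (A × A) × (A × A) | z.1.2 * star z.2.2 = z.1.1 * star z.2.1} :=
      fun z hz => hu₁ _ hz.1 _ hz.2
    have := closure_minimal hsub hcl (by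
      rw [closure_prod_eq]
      exact Set.mk_mem_prod (hmem p hp) (hmem q hq))
    exact this
  · obtain ⟨p, hp, hp0⟩ := Submodule.exists_mem_ne_zero_of_ne_bot h0
    have hp1 : (p.1, s⁻¹ • p.2) ∈ Γ₁ := by
      rw [hΓ₁, smul_inv_smul₀ hs0]
      exact hp
    have := Γ₁.le_topologicalClosure hp1
    rw [e, Submodule.mem_bot, Prod.mk_eq_zero] at this
    exact hp0 (Prod.ext this.1 (hΓ.snd_eq_zero hp this.1))

end ImplementingUnitary

/-! ### Nonzero ideals of the crossed product meet the coefficient algebra -/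

section Intersection

open CrossedProduct

variable {A G : Type*} [NonUnitalCStarAlgebra A] [Group G] [Fintype G] {α : G →* (A ≃⋆ₐ[ℂ] A)}

open scoped Classical in
/-- The support of an element of a crossed product. -/
def CrossedProduct.support (f : CrossedProduct α) : Finset G := Finset.univ.filter fun g => f g ≠ 0

lemma CrossedProduct.mem_support {f : CrossedProduct α} {g : G} : g ∈ f.support ↔ f g ≠ 0 := by
  simp [CrossedProduct.support]

open scoped Classical in
/-- For a properly outer action on a prime C*-algebra, nonzero ideals of the crossed product
intersect the coefficient algebra. -/
lemma exists_single_one_mem (hA : IsPrimeAlgebra A) (hα : IsProperlyOuter α)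
    {J : Submodule ℂ (CrossedProduct α)} (hJ : IsTwoSidedIdeal J) (h0 : J ≠ ⊥) :
    ∃ a : A, a ≠ 0 ∧ single α 1 a ∈ J := by
  have hex : ∃ n, ∃ f ∈ J, f ≠ 0 ∧ f.support.card ≤ n := by
    obtain ⟨f, hf, hf0⟩ := Submodule.exists_mem_ne_zero_of_ne_bot h0
    exact ⟨_, f, hf, hf0, le_rfl⟩
  obtain ⟨f₀, hf₀, hf₀0, hcard⟩ := Nat.find_spec hex
  have hmin : ∀ x ∈ J, x.support.card < Nat.find hex → x = 0 := fun x hx hlt => by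
    by_contra hne
    exact Nat.find_min hex hlt ⟨x, hx, hne, le_rfl⟩
  obtain ⟨s, hs⟩ : ∃ s, f₀ s ≠ 0 := by
    by_contra! h
    exact hf₀0 (CrossedProduct.ext h)
  -- Chosen so that `f(1) = f₀(s) f₀(s)* ≠ 0`, while `g ↦ g s` injects the support of `f` into that
  -- of `f₀`, so minimality is kept.
  set f := f₀ * single α s⁻¹ (α s⁻¹ (star (f₀ s))) with hf
  have hfJ : f ∈ J := (hJ _ _ hf₀).2
  have hf_apply : ∀ g, f g = f₀ (g * s) * α (g * s) (α s⁻¹ (star (f₀ s))) := fun g => by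
    rw [hf, mul_single_apply, inv_inv]
  have hf1 : f 1 ≠ 0 := by
    rw [hf_apply, one_mul, ← StarAlgEquiv.mul_apply, ← map_mul, mul_inv_cancel, map_one,
      StarAlgEquiv.one_apply, Ne, CStarRing.mul_star_self_eq_zero_iff]
    exact hs
  have hfcard : f.support.card ≤ Nat.find hex := by
    refine (Finset.card_le_card_of_injOn (fun g => g * s) (fun g hg => ?_)
      (mul_left_injective s).injOn).trans hcard
    rw [Finset.mem_coe, mem_support, hf_apply] at hg
    exact mem_support.2 (left_ne_zero_of_mul hg)
  clear_value f
  let X : Submodule ℂ (CrossedProduct α) :=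
    { carrier := {x | x ∈ J ∧ ∀ g, f g = 0 → x g = 0}
      add_mem' := fun {x y} hx hy => ⟨J.add_mem hx.1 hy.1, fun g hg => by
        rw [CrossedProduct.add_apply, hx.2 g hg, hy.2 g hg, add_zero]⟩
      zero_mem' := ⟨J.zero_mem, fun _ _ => rfl⟩
      smul_mem' := fun c x hx => ⟨J.smul_mem c hx.1, fun g hg => by
        rw [CrossedProduct.smul_apply, hx.2 g hg, smul_zero]⟩ }
  -- An element of `X` vanishing at a point of the support of `f` has strictly smaller support than
  -- the minimum.
  have hX : ∀ x ∈ X, ∀ t, f t ≠ 0 → x t = 0 → x = 0 := fun x hx t ht hxt => by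
    refine hmin x hx.1 ((Finset.card_lt_card ?_).trans_le hfcard)
    refine (Finset.ssubset_iff_of_subset fun g hg => ?_).2 ⟨t, mem_support.2 ht, fun h =>
      mem_support.1 h hxt⟩
    exact mem_support.2 fun h => mem_support.1 hg (hx.2 g h)
  have hXl : ∀ a, ∀ x ∈ X, single α 1 a * x ∈ X := fun a x hx => ⟨(hJ _ _ hx.1).1, fun g hg => by
    rw [single_mul_apply, inv_one, one_mul, hx.2 g hg, map_zero, mul_zero]⟩
  have hXr : ∀ a, ∀ x ∈ X, x * single α 1 a ∈ X := fun a x hx => ⟨(hJ _ _ hx.1).2, fun g hg => by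
    rw [mul_single_apply, inv_one, mul_one, hx.2 g hg, zero_mul]⟩
  by_cases hg : ∃ g, g ≠ 1 ∧ f g ≠ 0
  · obtain ⟨g, hg1, hg⟩ := hg
    exfalso
    refine hα g hg1 ?_
    -- The pairs `(x(1), x(g))`. Right multiplication by `a δ_1` acts by `a` at `1` and by `α_g(a)`
    -- at `g`, whence the twist.
    let Γ : Submodule ℂ (A × A) :=
      X.map ((evalCLM α 1).toLinearMap.prod (evalCLM α g).toLinearMap)
    have hΓ : IsTwistedGraph (α g) Γ :=
      { left := by
          rintro a _ ⟨x, hx, rfl⟩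
          refine ⟨_, hXl a x hx, Prod.ext ?_ ?_⟩
          · exact (single_mul_apply ..).trans (by simp)
          · exact (single_mul_apply ..).trans (by simp)
        right := by
          rintro a _ ⟨x, hx, rfl⟩
          refine ⟨_, hXr a x hx, Prod.ext ?_ ?_⟩
          · exact (mul_single_apply ..).trans (by simp)
          · exact (mul_single_apply ..).trans (by simp)
        snd_eq_zero := by
          rintro _ ⟨x, hx, rfl⟩ h
          rw [hX x hx 1 hf1 h]
          rfl
        fst_eq_zero := by
          rintro _ ⟨x, hx, rfl⟩ h
          rw [hX x hx g hg h]
          rfl }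
    refine hΓ.exists_unitary hA fun e => hf1 ?_
    have : (f 1, f g) ∈ Γ := ⟨f, ⟨hfJ, fun _ h => h⟩, rfl⟩
    rw [e, Submodule.mem_bot, Prod.mk_eq_zero] at this
    exact this.1
  · push Not at hg
    refine ⟨f 1, hf1, ?_⟩
    convert hfJ using 1
    ext g
    by_cases h : g = 1
    · rw [h, single_apply_self]
    · rw [single_apply_of_ne h, hg g h]

end Intersection

/-! ### Invariant ideals of `A` and essential ideals of `A ⋊ G` -/

section InvariantIdeals

open CrossedProduct

variable {A : Type u} {G : Type v} [NonUnitalCStarAlgebra A] [Group G] [Fintype G]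
  {α : G →* (A ≃⋆ₐ[ℂ] A)}

/-- Invariance of an ideal under an action. -/
def IsInvariantIdeal (α : G →* (A ≃⋆ₐ[ℂ] A)) (I : EssentialIdeal A) : Prop :=
  ∀ g, ∀ x ∈ I, α g x ∈ I

lemma IsInvariantIdeal.symm_mem {I : EssentialIdeal A} (hI : IsInvariantIdeal α I) (g : G) {x : A}
    (hx : x ∈ I) : (α g).symm x ∈ I := by
  have := hI g⁻¹ x hx
  rwa [map_inv] at this

/-- The largest invariant ideal contained in `I`. -/
def invariantCore (α : G →* (A ≃⋆ₐ[ℂ] A)) (I : EssentialIdeal A) : EssentialIdeal A where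
  carrier := ⨅ g, I.carrier.comap (equivCLM (α g)).toLinearMap
  isTwoSided a x hx := by
    simp only [Submodule.mem_iInf] at hx ⊢
    refine ⟨fun g => ?_, fun g => ?_⟩
    · have := I.mul_mem_left (α g a) (hx g)
      rw [ContinuousLinearMap.coe_coe, equivCLM_apply, ← map_mul] at this
      exact this
    · have := I.mul_mem_right (α g a) (hx g)
      rw [ContinuousLinearMap.coe_coe, equivCLM_apply, ← map_mul] at this
      exact this
  isClosed := by
    rw [Submodule.coe_iInf]
    exact isClosed_iInter fun g => I.isClosed.preimage (equivCLM (α g)).continuous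
  isEssential a ha := by
    -- Finiteness of `G` enters here: finitely many translates of `I` contain a common essential
    -- ideal.
    obtain ⟨K, hK⟩ := Finite.exists_le fun g : G => OrderDual.toDual (I.map (α g).symm)
    refine (OrderDual.ofDual K).isEssential a fun x hx => ha x ?_
    simp only [Submodule.mem_iInf]
    exact fun g => hK g hx

lemma mem_invariantCore {I : EssentialIdeal A} {x : A} :
    x ∈ invariantCore α I ↔ ∀ g, α g x ∈ I := by
  change x ∈ (⨅ g, I.carrier.comap (equivCLM (α g)).toLinearMap) ↔ _
  simp only [Submodule.mem_iInf]
  rfl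

lemma invariantCore_le (I : EssentialIdeal A) : invariantCore α I ≤ I := fun x hx => by
  have := mem_invariantCore.1 hx 1
  rwa [map_one] at this

lemma isInvariantIdeal_invariantCore (I : EssentialIdeal A) :
    IsInvariantIdeal α (invariantCore α I) := fun g x hx => mem_invariantCore.2 fun h => by
  rw [← StarAlgEquiv.mul_apply, ← map_mul]
  exact mem_invariantCore.1 hx _

/-- The ideal `I ⋊ G` of `A ⋊ G`. -/
def crossIdeal (I : EssentialIdeal A) (hI : IsInvariantIdeal α I) :
    EssentialIdeal (CrossedProduct α) where
  carrier := ⨅ g, I.carrier.comap (evalCLM α g).toLinearMap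
  isTwoSided a x hx := by
    simp only [Submodule.mem_iInf] at hx ⊢
    exact ⟨fun g => Submodule.sum_mem _ fun p _ => I.mul_mem_left _ (hI p _ (hx _)),
      fun g => Submodule.sum_mem _ fun p _ => I.mul_mem_right _ (hx _)⟩
  isClosed := by
    rw [Submodule.coe_iInf]
    exact isClosed_iInter fun g => I.isClosed.preimage (evalCLM α g).continuous
  isEssential f hf := by
    ext g
    refine I.isEssential _ fun x hx => ?_
    -- The value at `g` of this product is `f(g) x`.
    have h := congrFun (hf (single α 1 ((α g).symm x)) ?_) g
    · rw [mul_single_apply] at h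
      simpa using h
    · simp only [Submodule.mem_iInf]
      intro t
      change single α 1 _ t ∈ I
      by_cases ht : t = 1
      · rw [ht, single_apply_self]
        exact hI.symm_mem g hx
      · rw [single_apply_of_ne ht]
        exact zero_mem I

lemma mem_crossIdeal {I : EssentialIdeal A} {hI : IsInvariantIdeal α I} {f : CrossedProduct α} :
    f ∈ crossIdeal I hI ↔ ∀ g, f g ∈ I := by
  change f ∈ (⨅ g, I.carrier.comap (evalCLM α g).toLinearMap) ↔ _
  simp only [Submodule.mem_iInf]
  rfl

lemma single_mem_crossIdeal {I : EssentialIdeal A} {hI : IsInvariantIdeal α I} (t : G) {a : A}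
    (ha : a ∈ I) : single α t a ∈ crossIdeal I hI := mem_crossIdeal.2 fun g => by
  by_cases ht : g = t
  · rwa [ht, single_apply_self]
  · rw [single_apply_of_ne ht]
    exact zero_mem I

lemma isTwoSidedIdeal_comap_single (J : EssentialIdeal (CrossedProduct α)) :
    IsTwoSidedIdeal (J.carrier.comap (singleCLM α 1).toLinearMap) := fun a x hx => by
  have h1 := J.mul_mem_left (single α 1 a) hx
  have h2 := J.mul_mem_right (single α 1 a) hx
  change single α 1 a * single α 1 x ∈ J at h1
  change single α 1 x * single α 1 a ∈ J at h2
  rw [single_mul_single, one_mul, map_one] at h1 h2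
  exact ⟨h1, h2⟩

/-- The intersection of an essential ideal of `A ⋊ G` with `A`. -/
def coeffIdeal (hA : IsPrimeAlgebra A) (hα : IsProperlyOuter α)
    (J : EssentialIdeal (CrossedProduct α)) : EssentialIdeal A where
  carrier := J.carrier.comap (singleCLM α 1).toLinearMap
  isTwoSided := isTwoSidedIdeal_comap_single J
  isClosed := J.isClosed.preimage (singleCLM α 1).continuous
  isEssential a ha := by
    by_contra h0
    -- By primeness only nonvanishing is needed. The ideal `J` is itself nonzero, since otherwise
    -- its essentiality would annihilate `a δ_1`.
    refine h0 (hA (J.carrier.comap (singleCLM α 1).toLinearMap) (isTwoSidedIdeal_comap_single J)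
      (fun e => ?_) a ha)
    obtain ⟨b, hb0, hb⟩ := exists_single_one_mem hA hα J.isTwoSided fun hJ => h0 (by
      have := J.isEssential (single α 1 a) fun x hx => by
        rw [hJ, Submodule.mem_bot] at hx
        rw [hx, mul_zero]
      have h := congrFun this 1
      rwa [single_apply_self] at h)
    have hb' : b ∈ J.carrier.comap (singleCLM α 1).toLinearMap := hb
    rw [e, Submodule.mem_bot] at hb'
    exact hb0 hb'

variable {hA : IsPrimeAlgebra A} {hα : IsProperlyOuter α}

lemma mem_coeffIdeal {J : EssentialIdeal (CrossedProduct α)} {a : A} :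
    a ∈ coeffIdeal hA hα J ↔ single α 1 a ∈ J := Iff.rfl

lemma coeffIdeal_mono {J J' : EssentialIdeal (CrossedProduct α)} (h : J ≤ J') :
    coeffIdeal hA hα J ≤ coeffIdeal hA hα J' := fun _ ha => h ha

/-- `(a w) δ_t = (a δ_1)(w δ_t)` lies in `J`, and `a` is a limit of such `a w`; this replaces
multiplication by `δ_t`, which need not belong to `A ⋊ G`. -/
lemma single_mem_of_mem_coeffIdeal {J : EssentialIdeal (CrossedProduct α)} (t : G) {a : A}
    (ha : a ∈ coeffIdeal hA hα J) : single α t a ∈ J := by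
  have hc : IsClosed {b : A | single α t b ∈ J} :=
    J.isClosed_coe.preimage (singleCLM α t).continuous
  refine hc.closure_subset_iff.2 ?_ (mem_closure_mul A a)
  rintro _ ⟨w, rfl⟩
  have := J.mul_mem_right (single α t w) (mem_coeffIdeal.1 ha)
  rw [single_mul_single, one_mul, map_one] at this
  exact this

lemma crossIdeal_le_of_le {J : EssentialIdeal (CrossedProduct α)} {I : EssentialIdeal A}
    (hI : IsInvariantIdeal α I) (h : I ≤ coeffIdeal hA hα J) : crossIdeal I hI ≤ J :=
  fun f hf => by
    rw [← sum_single f]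
    exact Submodule.sum_mem J.carrier fun g _ =>
      single_mem_of_mem_coeffIdeal g (h (mem_crossIdeal.1 hf g))

/-- `α_g(w x) δ_1 = (α_g(w) δ_g)(x δ_{g⁻¹})`, and `x` is a limit of products `w x`. -/
lemma isInvariantIdeal_coeffIdeal (J : EssentialIdeal (CrossedProduct α)) :
    IsInvariantIdeal α (coeffIdeal hA hα J) := fun g x hx => by
  have hc : IsClosed {b : A | single α 1 (α g b) ∈ J} :=
    J.isClosed_coe.preimage ((singleCLM α 1).comp (equivCLM (α g))).continuous
  refine hc.closure_subset_iff.2 ?_ (mem_closure_mul' A x)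
  rintro _ ⟨w, rfl⟩
  have h1 := J.mul_mem_left (single α g (α g w)) (single_mem_of_mem_coeffIdeal g⁻¹ hx)
  rw [single_mul_single, mul_inv_cancel, ← map_mul] at h1
  exact h1

end InvariantIdeals

/-! ### Part b): the isomorphism of local multiplier algebras -/

section LocalMultiplierIsomorphism

open CrossedProduct

variable {A : Type u} {G : Type v} [NonUnitalCStarAlgebra A] [Group G] [Fintype G]
  {α : G →* (A ≃⋆ₐ[ℂ] A)}

/-- The restriction of an action to an invariant ideal. -/
def restrictAction (I : EssentialIdeal A) (hI : IsInvariantIdeal α I) : G →* (I ≃⋆ₐ[ℂ] I) where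
  toFun g :=
    { toFun := fun x => ⟨α g x, hI g x x.2⟩
      invFun := fun x => ⟨(α g).symm x, hI.symm_mem g x.2⟩
      left_inv := fun x => Subtype.ext ((α g).symm_apply_apply x)
      right_inv := fun x => Subtype.ext ((α g).apply_symm_apply x)
      map_mul' := fun x y => Subtype.ext (map_mul (α g) (x : A) y)
      map_add' := fun x y => Subtype.ext (map_add (α g) (x : A) y)
      map_star' := fun x => Subtype.ext (map_star (α g) (x : A))
      map_smul' := fun c x => Subtype.ext (map_smul (α g) c (x : A)) }
  map_one' := StarAlgEquiv.ext fun x => Subtype.ext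
    (congrArg (fun e : A ≃⋆ₐ[ℂ] A => e x) (map_one α))
  map_mul' g h := StarAlgEquiv.ext fun x => Subtype.ext
    (congrArg (fun e : A ≃⋆ₐ[ℂ] A => e x) (map_mul α g h))

variable {I I' : EssentialIdeal A} (hI : IsInvariantIdeal α I) (hI' : IsInvariantIdeal α I')

@[simp] lemma coe_sum_mem {κ : Type*} (s : Finset κ) (F : κ → I) :
    ((∑ p ∈ s, F p : I) : A) = ∑ p ∈ s, (F p : A) :=
  map_sum ({ toFun := Subtype.val, map_zero' := rfl, map_add' := fun _ _ => rfl } : I →+ A) F s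

/-- The ideal `I ⋊ G` of `A ⋊ G` is the crossed product of `I` by the restricted action. -/
def crossIdealEquiv : crossIdeal I hI ≃⋆ₐ[ℂ] CrossedProduct (restrictAction I hI) where
  toFun f := ofFun _ fun g => ⟨(f : CrossedProduct α) g, mem_crossIdeal.1 f.2 g⟩
  invFun f := ⟨ofFun α fun g => (f g : A), mem_crossIdeal.2 fun g => (f g).2⟩
  left_inv _ := rfl
  right_inv _ := rfl
  map_mul' f h := by
    ext g
    rw [CrossedProduct.mul_apply, coe_sum_mem]
    rfl
  map_add' _ _ := rfl
  map_star' _ := rfl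
  map_smul' _ _ := rfl

lemma crossIdealEquiv_apply (f : crossIdeal I hI) (g : G) :
    (crossIdealEquiv hI f g : A) = (f : CrossedProduct α) g := rfl

lemma crossIdealEquiv_symm_single (t : G) (a : I) :
    (((crossIdealEquiv hI).symm (single _ t a) : crossIdeal I hI) : CrossedProduct α) =
      single α t (a : A) := by
  ext g
  change (single (restrictAction I hI) t a g : A) = _
  by_cases h : g = t
  · rw [h, single_apply_self, single_apply_self]
  · rw [single_apply_of_ne h, single_apply_of_ne h]
    rfl

/-- Equivariance of `M(I) → M_loc(A)`. The ideals `I` and `α_g(I)` have the same elements but are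
different expressions, so the comparison goes through restriction. -/
lemma localMultiplierAction_ofMultiplier (g : G) (m : 𝓜(ℂ, I)) :
    LocalMultipliers.ofMultiplier I (multiplierAction (restrictAction I hI) g m) =
      localMultiplierAction α g (LocalMultipliers.ofMultiplier I m) := by
  refine Eq.trans ?_ (LocalMultipliers.equiv_ofMultiplier (α g) I m).symm
  refine congrArg LocalMultipliers.ofPre (PreLocalMultipliers.mk_congr ?_ ?_ ?_)
  · exact fun x hx => hI.symm_mem g hx
  · exact fun x => rfl
  · exact fun x => rfl

lemma ofMultiplier_injective : Function.Injective (LocalMultipliers.ofMultiplier I) := by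
  rw [injective_iff_map_eq_zero]
  intro m hm
  have : ‖LocalMultipliers.ofPre (PreLocalMultipliers.mk I m)‖ = 0 := norm_eq_zero.2 hm
  rwa [LocalMultipliers.norm_ofPre, PreLocalMultipliers.norm_mk, norm_eq_zero] at this

/-- The embedding of `M(I) ⋊ G` into `M_loc(A) ⋊ G`. -/
def localHom : CrossedProduct (multiplierAction (restrictAction I hI)) →⋆ₙₐ[ℂ]
    CrossedProduct (localMultiplierAction α) :=
  CrossedProduct.map (LocalMultipliers.ofMultiplier I).toNonUnitalStarAlgHom
    (localMultiplierAction_ofMultiplier hI)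

lemma localHom_injective : Function.Injective (localHom hI) :=
  map_injective _ _ ofMultiplier_injective

variable {J J' : EssentialIdeal (CrossedProduct α)}

/-- The canonical `*`-isomorphism of `M(I ⋊ G)` onto `M(I) ⋊ G`. -/
def crossIdealMultiplierEquiv : 𝓜(ℂ, crossIdeal I hI) ≃⋆ₐ[ℂ]
    CrossedProduct (multiplierAction (restrictAction I hI)) :=
  (multiplierEquiv (crossIdealEquiv hI)).trans (crossedEquiv (restrictAction I hI))

/-- The embedding of `M(J)` into `M_loc(A) ⋊ G` when `J` contains `I ⋊ G`. -/
def crossHom (h : crossIdeal I hI ≤ J) :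
    𝓜(ℂ, J) →⋆ₙₐ[ℂ] CrossedProduct (localMultiplierAction α) :=
  ((localHom hI).comp (crossIdealMultiplierEquiv hI : _ →⋆ₙₐ[ℂ] _)).comp
    (restrict h).toNonUnitalStarAlgHom

lemma crossHom_injective (h : crossIdeal I hI ≤ J) : Function.Injective (crossHom hI h) :=
  (localHom_injective hI).comp
    ((crossIdealMultiplierEquiv hI).injective.comp (restrict_injective h))

lemma crossHom_apply (h : crossIdeal I hI ≤ J) (m : 𝓜(ℂ, J)) (g : G) :
    crossHom hI h m g =
      LocalMultipliers.ofMultiplier I (crossIdealMultiplierEquiv hI (restrict h m) g) := rfl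

/-- The coefficients are expressed through the action of `m` on `A δ_1` alone, so shrinking `I` or
`J` merely restricts them. -/
lemma crossIdealMultiplierEquiv_fst (h : crossIdeal I hI ≤ J) (m : 𝓜(ℂ, J)) (g : G) (a : I) :
    ((crossIdealMultiplierEquiv hI (restrict h m) g).fst a : A) =
      (m.fst ⟨single α 1 (α g⁻¹ a), h (single_mem_crossIdeal 1 (hI _ _ a.2))⟩ :
        CrossedProduct α) g := by
  change ((crossedEquiv _ (multiplierEquiv (crossIdealEquiv hI) (restrict h m)) g).fst a : A) =
    _
  rw [crossedEquiv_fst, multiplierEquiv_fst, crossIdealEquiv_apply, restrict_fst]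
  exact congrArg (fun z : J => (z : CrossedProduct α) g)
    (congrArg m.fst (Subtype.ext (crossIdealEquiv_symm_single hI 1 _)))

lemma crossIdealMultiplierEquiv_snd (h : crossIdeal I hI ≤ J) (m : 𝓜(ℂ, J)) (g : G) (a : I) :
    ((crossIdealMultiplierEquiv hI (restrict h m) g).snd a : A) =
      (m.snd ⟨single α 1 a, h (single_mem_crossIdeal 1 a.2)⟩ : CrossedProduct α) g := by
  change ((crossedEquiv _ (multiplierEquiv (crossIdealEquiv hI) (restrict h m)) g).snd a : A) =
    _
  rw [crossedEquiv_snd, multiplierEquiv_snd, crossIdealEquiv_apply, restrict_snd]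
  exact congrArg (fun z : J => (z : CrossedProduct α) g)
    (congrArg m.snd (Subtype.ext (crossIdealEquiv_symm_single hI 1 _)))

/-- The embedding of `M(J)` does not depend on the choice of `I`. -/
lemma crossHom_congr (h : crossIdeal I hI ≤ J) (h' : crossIdeal I' hI' ≤ J') (hII : I' ≤ I)
    (hJJ : J' ≤ J) (m : 𝓜(ℂ, J)) : crossHom hI' h' (restrict hJJ m) = crossHom hI h m := by
  ext1 g
  rw [crossHom_apply, crossHom_apply]
  refine congrArg LocalMultipliers.ofPre (PreLocalMultipliers.mk_congr hII (fun x => ?_)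
    fun x => ?_)
  · rw [crossIdealMultiplierEquiv_fst, crossIdealMultiplierEquiv_fst]
    rfl
  · rw [crossIdealMultiplierEquiv_snd, crossIdealMultiplierEquiv_snd]
    rfl

variable (hA : IsPrimeAlgebra A) (hα : IsProperlyOuter α)

variable (J) in
/-- The embedding of `M(J)` into `M_loc(A) ⋊ G` for an essential ideal `J` of `A ⋊ G`. -/
def idealHom : 𝓜(ℂ, J) →⋆ₙₐ[ℂ] CrossedProduct (localMultiplierAction α) :=
  crossHom (isInvariantIdeal_coeffIdeal (hA := hA) (hα := hα) J)
    (crossIdeal_le_of_le (hA := hA) (hα := hα) _ le_rfl)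

lemma idealHom_restrict (h : J' ≤ J) (m : 𝓜(ℂ, J)) :
    idealHom J' hA hα (restrict h m) = idealHom J hA hα m :=
  crossHom_congr _ _ _ _ (coeffIdeal_mono h) h m

/-- Any such `I` lies in the coefficient ideal of `J`, so a more convenient invariant ideal may be
used for computations. -/
lemma idealHom_eq_crossHom (h : crossIdeal I hI ≤ J) (m : 𝓜(ℂ, J)) :
    idealHom J hA hα m = crossHom hI h m := by
  have hle : I ≤ coeffIdeal hA hα J := fun a ha =>
    mem_coeffIdeal.2 (h (single_mem_crossIdeal 1 ha))
  refine (crossHom_congr _ hI _ h hle le_rfl m).symm.trans ?_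
  congr 1

/-- The map from the algebraic direct limit to `M_loc(A) ⋊ G`. -/
def preMap : PreLocalMultipliers (CrossedProduct α) → CrossedProduct (localMultiplierAction α) :=
  DirectLimit.lift (transition (CrossedProduct α))
    (fun J m => idealHom (OrderDual.ofDual J) hA hα m)
    (fun J I h m => (idealHom_restrict (J := OrderDual.ofDual J) (J' := OrderDual.ofDual I)
      hA hα h m).symm)

lemma preMap_mk (m : 𝓜(ℂ, J)) : preMap hA hα (PreLocalMultipliers.mk J m) = idealHom J hA hα m :=
  rfl

lemma preMap_add (x y : PreLocalMultipliers (CrossedProduct α)) :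
    preMap hA hα (x + y) = preMap hA hα x + preMap hA hα y := by
  induction x, y using PreLocalMultipliers.induction₂ with
  | h I m n => rw [PreLocalMultipliers.mk_add, preMap_mk, preMap_mk, preMap_mk, map_add]

lemma preMap_mul (x y : PreLocalMultipliers (CrossedProduct α)) :
    preMap hA hα (x * y) = preMap hA hα x * preMap hA hα y := by
  induction x, y using PreLocalMultipliers.induction₂ with
  | h I m n => rw [PreLocalMultipliers.mk_mul, preMap_mk, preMap_mk, preMap_mk, map_mul]

lemma preMap_star (x : PreLocalMultipliers (CrossedProduct α)) :
    preMap hA hα (star x) = star (preMap hA hα x) := by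
  induction x using PreLocalMultipliers.induction with
  | h I m => rw [PreLocalMultipliers.mk_star, preMap_mk, preMap_mk, map_star]

lemma preMap_smul (c : ℂ) (x : PreLocalMultipliers (CrossedProduct α)) :
    preMap hA hα (c • x) = c • preMap hA hα x := by
  induction x using PreLocalMultipliers.induction with
  | h I m => rw [PreLocalMultipliers.mk_smul, preMap_mk, preMap_mk, map_smul]

lemma norm_preMap (x : PreLocalMultipliers (CrossedProduct α)) : ‖preMap hA hα x‖ = ‖x‖ := by
  induction x using PreLocalMultipliers.induction with
  | h I m =>
    rw [preMap_mk, PreLocalMultipliers.norm_mk]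
    exact NonUnitalStarAlgHom.norm_map _ (crossHom_injective _ _) m

lemma isometry_preMap : Isometry (preMap hA hα) :=
  AddMonoidHomClass.isometry_of_norm (AddMonoidHom.mk' (preMap hA hα) (preMap_add hA hα))
    (norm_preMap hA hα)

lemma preMap_of (x : CrossedProduct α) (g : G) :
    preMap hA hα (PreLocalMultipliers.mk ⊤ (((⟨x, EssentialIdeal.mem_top x⟩ :
      (⊤ : EssentialIdeal (CrossedProduct α))) : 𝓜(ℂ, (⊤ : EssentialIdeal (CrossedProduct α)))))) g
      = LocalMultipliers.of (x g) := by
  have hI : IsInvariantIdeal α ⊤ := fun _ _ _ => trivial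
  rw [preMap_mk, idealHom_eq_crossHom (I := ⊤) hI hA hα (EssentialIdeal.le_top' _), crossHom_apply]
  refine congrArg LocalMultipliers.ofPre (congrArg (PreLocalMultipliers.mk ⊤)
    (multiplier_ext_snd fun a => Subtype.ext ?_))
  rw [crossIdealMultiplierEquiv_snd]
  change (single α 1 (a : A) * x) g = a * x g
  simp [single_mul_apply]

/-- The finitely many coefficients are approximated by multipliers of ideals `K g`. All of these
restrict to one invariant ideal `I`, and `M(I) ⋊ G` is the image of `M(I ⋊ G)`. -/
lemma denseRange_preMap : DenseRange (preMap hA hα) := by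
  rw [Metric.denseRange_iff]
  intro F ε hε
  -- The extra `1` makes the sum of `|G|` errors strictly less than `ε`.
  set δ : ℝ := ε / (Fintype.card G + 1) with hδ
  have hδ0 : 0 < δ := by positivity
  have happrox : ∀ g, ∃ (K : EssentialIdeal A) (m : 𝓜(ℂ, K)),
      dist (F g) (LocalMultipliers.ofMultiplier K m) < δ := fun g => by
    obtain ⟨x, hx⟩ := LocalMultipliers.denseRange_ofPre.exists_dist_lt (F g) hδ0
    induction x using PreLocalMultipliers.induction with
    | h K m => exact ⟨K, m, hx⟩
  choose K m hm using happrox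
  obtain ⟨L, hL⟩ := Finite.exists_le fun g : G => OrderDual.toDual (K g)
  let I := invariantCore α (OrderDual.ofDual L)
  have hI : IsInvariantIdeal α I := isInvariantIdeal_invariantCore _
  have hIK : ∀ g, I ≤ K g := fun g => (invariantCore_le _).trans (hL g)
  let F' : CrossedProduct (multiplierAction (restrictAction I hI)) :=
    ofFun _ fun g => restrict (hIK g) (m g)
  refine ⟨PreLocalMultipliers.mk (crossIdeal I hI) ((crossIdealMultiplierEquiv hI).symm F'), ?_⟩
  have hF' : preMap hA hα (PreLocalMultipliers.mk (crossIdeal I hI)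
      ((crossIdealMultiplierEquiv hI).symm F')) = localHom hI F' := by
    rw [preMap_mk, idealHom_eq_crossHom hI hA hα le_rfl]
    change localHom hI (crossIdealMultiplierEquiv hI ((crossIdealMultiplierEquiv hI).symm F')) = _
    rw [StarAlgEquiv.apply_symm_apply]
  rw [hF', dist_eq_norm]
  calc _ ≤ ∑ g : G, ‖(F - localHom hI F') g‖ := norm_le_sum _
    _ ≤ ∑ _g : G, δ := Finset.sum_le_sum fun g _ => by
      have h1 : localHom hI F' g = LocalMultipliers.ofMultiplier (K g) (m g) :=
        congrArg LocalMultipliers.ofPre (PreLocalMultipliers.mk_restrict (hIK g) (m g))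
      rw [CrossedProduct.sub_apply, h1, ← dist_eq_norm]
      exact (hm g).le
    _ < ε := by
      rw [Finset.sum_const, Finset.card_univ, nsmul_eq_mul, hδ, mul_div_assoc',
        div_lt_iff₀ (by positivity)]
      nlinarith

/-- The extension of `preMap` to `M_loc(A ⋊ G)`. -/
def localMap : LocalMultipliers (CrossedProduct α) → CrossedProduct (localMultiplierAction α) :=
  UniformSpace.Completion.extension (preMap hA hα)

lemma localMap_ofPre (x : PreLocalMultipliers (CrossedProduct α)) :
    localMap hA hα (LocalMultipliers.ofPre x) = preMap hA hα x :=
  UniformSpace.Completion.extension_coe (isometry_preMap hA hα).uniformContinuous x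

lemma isometry_localMap : Isometry (localMap hA hα) :=
  (isometry_preMap hA hα).completion_extension

/-- The range is closed, as an isometric image of a complete space, and dense. -/
lemma surjective_localMap : Function.Surjective (localMap hA hα) := by
  rw [← Set.range_eq_univ, ← (isometry_localMap hA hα).isClosedEmbedding.isClosed_range.closure_eq]
  refine ((denseRange_preMap hA hα).mono ?_).closure_eq
  rintro _ ⟨x, rfl⟩
  exact ⟨_, localMap_ofPre hA hα x⟩

lemma continuous_localMap : Continuous (localMap hA hα) := (isometry_localMap hA hα).continuous

lemma localMap_mul (x y : LocalMultipliers (CrossedProduct α)) :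
    localMap hA hα (x * y) = localMap hA hα x * localMap hA hα y := by
  have hc := continuous_localMap hA hα
  refine LocalMultipliers.induction_on₂
    (p := fun x y => localMap hA hα (x * y) = localMap hA hα x * localMap hA hα y) x y
    (isClosed_eq (hc.comp continuous_mul)
      ((hc.comp continuous_fst).mul (hc.comp continuous_snd))) fun x y => ?_
  rw [← map_mul LocalMultipliers.ofPre, localMap_ofPre, localMap_ofPre, localMap_ofPre, preMap_mul]

lemma localMap_add (x y : LocalMultipliers (CrossedProduct α)) :
    localMap hA hα (x + y) = localMap hA hα x + localMap hA hα y := by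
  have hc := continuous_localMap hA hα
  refine LocalMultipliers.induction_on₂
    (p := fun x y => localMap hA hα (x + y) = localMap hA hα x + localMap hA hα y) x y
    (isClosed_eq (hc.comp continuous_add)
      ((hc.comp continuous_fst).add (hc.comp continuous_snd))) fun x y => ?_
  rw [← map_add LocalMultipliers.ofPre, localMap_ofPre, localMap_ofPre, localMap_ofPre, preMap_add]

lemma localMap_star (x : LocalMultipliers (CrossedProduct α)) :
    localMap hA hα (star x) = star (localMap hA hα x) := by
  have hc := continuous_localMap hA hα
  refine LocalMultipliers.induction_on
    (p := fun x => localMap hA hα (star x) = star (localMap hA hα x)) x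
    (isClosed_eq (hc.comp continuous_star) (continuous_star.comp hc)) fun x => ?_
  rw [← map_star LocalMultipliers.ofPre, localMap_ofPre, localMap_ofPre, preMap_star]

lemma localMap_smul (c : ℂ) (x : LocalMultipliers (CrossedProduct α)) :
    localMap hA hα (c • x) = c • localMap hA hα x := by
  have hc := continuous_localMap hA hα
  refine LocalMultipliers.induction_on
    (p := fun x => localMap hA hα (c • x) = c • localMap hA hα x) x
    (isClosed_eq (hc.comp (continuous_const_smul c)) (hc.const_smul c)) fun x => ?_
  rw [← map_smul LocalMultipliers.ofPre, localMap_ofPre, localMap_ofPre, preMap_smul]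

/-- The `*`-isomorphism of `M_loc(A ⋊ G)` onto `M_loc(A) ⋊ G`. -/
def localMultipliersEquiv :
    LocalMultipliers (CrossedProduct α) ≃⋆ₐ[ℂ] CrossedProduct (localMultiplierAction α) where
  __ := Equiv.ofBijective (localMap hA hα)
    ⟨(isometry_localMap hA hα).injective, surjective_localMap hA hα⟩
  map_mul' := localMap_mul hA hα
  map_add' := localMap_add hA hα
  map_star' := localMap_star hA hα
  map_smul' := localMap_smul hA hα

lemma localMultipliersEquiv_of (x : CrossedProduct α) (g : G) :
    localMultipliersEquiv hA hα (LocalMultipliers.of x) g = LocalMultipliers.of (x g) := by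
  rw [← preMap_of hA hα]
  exact congrFun (localMap_ofPre hA hα _) g

end LocalMultiplierIsomorphism

end CStarDyn

end

theorem lemma10 {A G : Type*} [NonUnitalCStarAlgebra A] [Group G] [Fintype G]
    (α : G →* (A ≃⋆ₐ[ℂ] A)) :
    (∃ Φ : 𝓜(ℂ, CrossedProduct α) ≃⋆ₐ[ℂ] CrossedProduct (multiplierAction α),
      ∀ (x : CrossedProduct α) (g : G),
        Φ (x : 𝓜(ℂ, CrossedProduct α)) g = ((x g : A) : 𝓜(ℂ, A))) ∧
    (IsPrimeAlgebra A → IsProperlyOuter α →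
      ∃ Ψ : LocalMultipliers (CrossedProduct α) ≃⋆ₐ[ℂ] CrossedProduct (localMultiplierAction α),
        ∀ (x : CrossedProduct α) (g : G),
          Ψ (LocalMultipliers.of x) g = LocalMultipliers.of (x g : A)) :=
  ⟨⟨CrossedProduct.crossedEquiv α, fun x g =>
      congrFun (CrossedProduct.crossedEquiv_coe α x) g⟩,
    fun hA hα => ⟨localMultipliersEquiv hA hα, localMultipliersEquiv_of hA hα⟩⟩
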